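/- Let $\lambda, k, r$ be integers with $k\ge r>\lambda\ge 0$, let $\eta\ge 1$ be an integer and let $\alpha_1,\dots,\alpha_\lambda$ be integers with $$0<\alpha_1<\cdots<\alpha_\lambda<\eta,\qquad \alpha_i=\eta-\alpha_{\lambda+1-i}\quad(1\le i\le\lambda).$$ For complex $a$ and complex $q$ with $0<|q|<1$ write $(a;q)_\infty=\prod_{i\ge0}(1-aq^i)$, $(a;q)_n=(a;q)_\infty/(aq^n;q)_\infty$ for $n\in\mathbb Z$ (so $(a;q)_{-1}=1/(1-aq^{-1})$), and $(a_1,\dots,a_m;q)_\infty=\prod_{j=1}^m(a_j;q)_\infty$. Then for every complex $q$ with $0<|q|<1$ $$ \begin{aligned} &\sum_{N_1\ge\cdots\ge N_{k-1}\ge0} \frac{q^{\eta(N_1^2+\cdots+N_{k-1}^2+N_r+\cdots+N_{k-1})}\,(1+q^{-\eta N_r})\,(-q^{\eta-\eta N_{\lambda+1}};q^\eta)_{N_{\lambda+1}-1}\,(-q^{\eta+\eta N_\lambda};q^\eta)_\infty} {(q^\eta;q^\eta)_{N_1-N_2}\cdots(q^\eta;q^\eta)_{N_{k-2}-N_{k-1}}(q^\eta;q^\eta)_{N_{k-1}}}\\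 &\hskip1cm\times\prod_{s=1}^{\lambda}(-q^{\eta-\alpha_s-\eta N_s};q^\eta)_{N_s}\prod_{s=2}^{\lambda}(-q^{\eta-\alpha_s+\eta N_{s-1}};q^\eta)_\infty\\ &=\frac{(-q^{\alpha_1},\dots,-q^{\alpha_\lambda},-q^\eta;q^\eta)_\infty\,(q^{(r-\frac{\lambda}{2})\eta},q^{(2k-r-\frac{\lambda}{2})\eta},q^{(2k-\lambda)\eta};q^{(2k-\lambda)\eta})_\infty}{(q^\eta;q^\eta)_\infty}, \end{aligned} $$ where the multisum over integers converges absolutely. (The exponents on the right are integers, since $\lambda\eta=2\sum_i\alpha_i$ is even.) Conventions: $N_k=0$ (used when $r=k$ or $\lambda+1=k$; also, for $k=1$ the multisum is the single term with no summation variables); for $\lambda=0$ the factor $(-q^{\eta+\eta N_\lambda};q^\eta)_\infty$ is read with $N_0=\infty$, that is, as $1$; empty sums are $0$ and empty products are $1$. -/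

import Mathlib

open Finset

/-- The infinite `q`-shifted factorial `(a; q)_∞ = ∏_{i ≥ 0} (1 - a q^i)`. -/
noncomputable def qPochInf (a q : ℂ) : ℂ := ∏' i : ℕ, (1 - a * q ^ i)

/-- The infinite product defining `(a; q)_∞` converges when `|q| < 1`. -/
theorem multipliable_qPochInf (a : ℂ) {q : ℂ} (hq : ‖q‖ < 1) :
    Multipliable (fun i : ℕ => 1 - a * q ^ i) := by
  have h : Summable (fun i : ℕ => ‖-(a * q ^ i)‖) := by
    simp only [norm_neg, norm_mul, norm_pow]
    exact (summable_geometric_of_lt_one (norm_nonneg q) hq).mul_left ‖a‖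
  simpa [sub_eq_add_neg] using multipliable_one_add_of_summable h

/-- The `q`-shifted factorial `(a; q)_n = (a; q)_∞ / (a q^n; q)_∞`, for every integer `n`
(the value `n = -1` is needed below). -/
noncomputable def qPoch (a q : ℂ) (n : ℤ) : ℂ := qPochInf a q / qPochInf (a * q ^ n) q

/-- The standing assumption on the residues: `0 < α_1 < ⋯ < α_l < η` and
`α_i = η - α_{l+1-i}` for `1 ≤ i ≤ l`. Only the values `α 1, …, α l` matter. -/
structure IsAdmissible (l η : ℕ) (α : ℕ → ℕ) : Prop where
  eta_pos : 0 < η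
  pos : ∀ i ∈ Icc 1 l, 0 < α i
  lt_eta : ∀ i ∈ Icc 1 l, α i < η
  strictMono : StrictMonoOn α (Set.Icc 1 l)
  symm : ∀ i ∈ Icc 1 l, α i + α (l + 1 - i) = η

/-- `l * η` is even, so that the exponents `(r - l / 2) η` and `(2 k - r - l / 2) η` are integers
and the integer divisions by `2` in `productSide` are exact. -/
theorem IsAdmissible.two_dvd {l η : ℕ} {α : ℕ → ℕ} (h : IsAdmissible l η α) : 2 ∣ l * η := by
  have h1 : ∑ i ∈ Icc 1 l, α (l + 1 - i) = ∑ i ∈ Icc 1 l, α i := by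
    refine Finset.sum_nbij' (fun i => l + 1 - i) (fun i => l + 1 - i) ?_ ?_ ?_ ?_ ?_ <;>
      intro i hi <;> simp only [mem_Icc] at * <;> omega
  have h2 : ∑ i ∈ Icc 1 l, (α i + α (l + 1 - i)) = l * η := by
    rw [Finset.sum_congr rfl h.symm]; simp
  rw [Finset.sum_add_distrib, h1] at h2
  exact ⟨∑ i ∈ Icc 1 l, α i, by omega⟩

/-- The index set of the multisum: `N_1 ≥ N_2 ≥ ⋯ ≥ N_{k-1} ≥ 0`. -/
abbrev Chain (k : ℕ) : Type := {N : Fin (k - 1) → ℕ // Antitone N}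

/-- The entry `N_i` of a chain for `1 ≤ i ≤ k - 1`, with the convention `N_k = 0`. -/
def Chain.entry {k : ℕ} (N : Chain k) (i : ℕ) : ℕ :=
  if h : 1 ≤ i ∧ i ≤ k - 1 then N.1 ⟨i - 1, by omega⟩ else 0

/-- The factor `(-q^{η + η N_l}; q^η)_∞`. For `l = 0` it involves `N_0`, which is read as `∞`
(so that `q^{η + η N_0} = 0`); the factor is then `1`. -/
noncomputable def tailFactor {k : ℕ} (l η : ℕ) (q : ℂ) (N : Chain k) : ℂ :=
  if l = 0 then 1 else qPochInf (-q ^ (η + η * N.entry l)) (q ^ η)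

/-- The summand of the multisum. The denominator
`(q^η; q^η)_{N_1 - N_2} ⋯ (q^η; q^η)_{N_{k-2} - N_{k-1}} (q^η; q^η)_{N_{k-1}}`
is written as one product, using `N_k = 0`. -/
noncomputable def summand (k r l η : ℕ) (α : ℕ → ℕ) (q : ℂ) (N : Chain k) : ℂ :=
  q ^ (η * (∑ i ∈ Icc 1 (k - 1), N.entry i ^ 2 + ∑ i ∈ Icc r (k - 1), N.entry i))
      * (1 + q ^ (-((η : ℤ) * N.entry r)))
      * qPoch (-q ^ ((η : ℤ) - η * N.entry (l + 1))) (q ^ η) ((N.entry (l + 1) : ℤ) - 1)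
      * tailFactor l η q N
    / (∏ i ∈ Icc 1 (k - 1), qPoch (q ^ η) (q ^ η) ((N.entry i : ℤ) - N.entry (i + 1)))
    * (∏ s ∈ Icc 1 l, qPoch (-q ^ ((η : ℤ) - α s - η * N.entry s)) (q ^ η) (N.entry s))
    * (∏ s ∈ Icc 2 l, qPochInf (-q ^ ((η : ℤ) - α s + η * N.entry (s - 1))) (q ^ η))

/-- The product side
`(-q^{α_1}, …, -q^{α_l}, -q^η; q^η)_∞
  (q^{(r - l/2) η}, q^{(2k - r - l/2) η}, q^{(2k - l) η}; q^{(2k - l) η})_∞ / (q^η; q^η)_∞`. -/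
noncomputable def productSide (k r l η : ℕ) (α : ℕ → ℕ) (q : ℂ) : ℂ :=
  (∏ s ∈ Icc 1 l, qPochInf (-q ^ α s) (q ^ η)) * qPochInf (-q ^ η) (q ^ η)
    * (qPochInf (q ^ ((2 * (r : ℤ) - l) * η / 2)) (q ^ ((2 * (k : ℤ) - l) * η))
      * qPochInf (q ^ ((4 * (k : ℤ) - 2 * r - l) * η / 2)) (q ^ ((2 * (k : ℤ) - l) * η))
      * qPochInf (q ^ ((2 * (k : ℤ) - l) * η)) (q ^ ((2 * (k : ℤ) - l) * η)))
    / qPochInf (q ^ η) (q ^ η)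

/-! Put `p = q ^ η`. The identity comes from one chain of Bailey pairs, read from N_k = 0 up to N_0
= ∞. The summation `qVandermonde` yields the Bailey lemma `baileySum_step`, where one parameter is
-p^(c+1)/y and the other infinite; for y = 0 both are infinite. Writing y^n (-z/y; p)_n as `qHom y z
p n` covers both cases at once.

The chain starts at the unit pair relative to p (`baileySum_unit`). It makes k - r steps with y = 0,
moves to a pair relative to 1 by the factor 1 + p^(N_r) (`one_add_mul_baileySum`), and makes r
further steps with the values `stepParam`: zero above index λ + 1, p at λ + 1, and q^(η - α_i) for i
≤ λ. Each step introduces one summation variable, and the outermost one is taken in the limit L → ∞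
(`hasSum_limit_pathProd`, `hasSum_stepKernel`). After normalization its terms are exactly the
summands (`summand_eq`).

On the other side a single series remains. The quotients (-q^(α_i); p)_n / (-q^(η - α_i); p)_n
cancel in the product over i because the residues are symmetric. The step with y = p cancels the
factor 1 + p^n created by the change of base. What is left is twice a theta series of modulus p^(2k
- λ) (`coeff_eq`), which `tripleProduct` evaluates. The triple product itself is the limit of a
q-binomial sum of even length, centred at its middle. -/

/-! ### Finite q-shifted factorials. -/

/-- The finite `q`-shifted factorial `(a; p)_n = ∏_{i < n} (1 - a p^i)`. -/
noncomputable def qFin (a p : ℂ) (n : ℕ) : ℂ := ∏ i ∈ range n, (1 - a * p ^ i)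

/-- The product `∏_{j < n} (y + z p^j)`, a homogeneous form of the `q`-shifted factorial. -/
noncomputable def qHom (y z p : ℂ) (n : ℕ) : ℂ := ∏ j ∈ range n, (y + z * p ^ j)

@[simp] theorem qFin_zero (a p : ℂ) : qFin a p 0 = 1 := by simp [qFin]

@[simp] theorem qHom_zero (y z p : ℂ) : qHom y z p 0 = 1 := by simp [qHom]

theorem qFin_succ (a p : ℂ) (n : ℕ) : qFin a p (n + 1) = qFin a p n * (1 - a * p ^ n) := by
  simp [qFin, prod_range_succ]

theorem qFin_succ' (a p : ℂ) (n : ℕ) : qFin a p (n + 1) = (1 - a) * qFin (a * p) p n := by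
  simp only [qFin, prod_range_succ']
  rw [mul_comm]
  simp [pow_succ', mul_assoc]

theorem qHom_succ (y z p : ℂ) (n : ℕ) : qHom y z p (n + 1) = qHom y z p n * (y + z * p ^ n) := by
  simp [qHom, prod_range_succ]

theorem qHom_succ' (y z p : ℂ) (n : ℕ) :
    qHom y z p (n + 1) = (y + z) * qHom y (z * p) p n := by
  simp only [qHom, prod_range_succ']
  rw [mul_comm]
  simp [pow_succ', mul_assoc]

theorem qFin_add (a p : ℂ) (m n : ℕ) :
    qFin a p (m + n) = qFin a p m * qFin (a * p ^ m) p n := by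
  simp [qFin, prod_range_add, pow_add, mul_assoc]

theorem qHom_add (y z p : ℂ) (m n : ℕ) :
    qHom y z p (m + n) = qHom y z p m * qHom y (z * p ^ m) p n := by
  simp [qHom, prod_range_add, pow_add, mul_assoc]

theorem qHom_mul (c y z p : ℂ) (n : ℕ) : qHom (c * y) (c * z) p n = c ^ n * qHom y z p n := by
  induction n with
  | zero => simp
  | succ n ih => rw [qHom_succ, qHom_succ, ih]; ring

theorem qHom_one (z p : ℂ) (n : ℕ) : qHom 1 z p n = qFin (-z) p n := by
  simp [qHom, qFin]

theorem pow_choose_two (p : ℂ) (n : ℕ) : p ^ (n + 1).choose 2 = p ^ n.choose 2 * p ^ n := by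
  rw [Nat.choose_succ_succ' n 1, pow_add, mul_comm]; simp

/-- The case y = 0 plays the role of a Bailey parameter sent to infinity, so no separate limit is
needed. -/
theorem qHom_zero_left (z p : ℂ) (n : ℕ) : qHom 0 z p n = z ^ n * p ^ n.choose 2 := by
  induction n with
  | zero => simp
  | succ n ih => rw [qHom_succ, ih, pow_choose_two]; ring

theorem add_choose_two (n m : ℕ) : (n + m).choose 2 = n.choose 2 + m.choose 2 + n * m := by
  induction m with
  | zero => simp
  | succ m ih =>
    rw [← add_assoc, Nat.choose_succ_succ' (n + m) 1, Nat.choose_succ_succ' m 1, ih]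
    simp; ring

theorem qFin_ne_zero {a p : ℂ} (h : ∀ i, a * p ^ i ≠ 1) (n : ℕ) : qFin a p n ≠ 0 :=
  prod_ne_zero_iff.2 fun i _ => sub_ne_zero.2 (h i).symm

theorem qFin_self_ne_zero {p : ℂ} (h : ∀ i, p ^ (i + 1) ≠ 1) (n : ℕ) : qFin p p n ≠ 0 :=
  qFin_ne_zero (fun i => by rw [← pow_succ']; exact h i) n

/-! ### The q-Chu–Vandermonde sum and the Bailey lemma. -/

/-- A form of the `q`-Chu–Vandermonde sum; `z = 0` is the `q`-binomial theorem. -/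
theorem qVandermonde {p : ℂ} (hp : ∀ i, p ^ (i + 1) ≠ 1) (y z : ℂ) (hz : ∀ i, z * p ^ i ≠ 1)
    (n : ℕ) :
    ∑ m ∈ range (n + 1), p ^ m.choose 2 * qHom y z p m
        / (qFin p p m * qFin p p (n - m) * qFin z p m)
      = qFin (-y) p n / (qFin p p n * qFin z p n) := by
  induction n generalizing z with
  | zero => simp
  | succ n ih =>
    have hz' : ∀ i, z * p * p ^ i ≠ 1 := fun i => by
      rw [mul_assoc, ← pow_succ']; exact hz _
    have h0 := qFin_self_ne_zero hp
    have h1 := qFin_ne_zero hz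
    have h2 := qFin_ne_zero hz'
    have hn : (1 - p ^ (n + 1)) ≠ 0 := sub_ne_zero.2 (hp n).symm
    have hzn : (1 - z * p ^ n) ≠ 0 := sub_ne_zero.2 (hz n).symm
    have hz0 : (1 - z) ≠ 0 := by simpa using sub_ne_zero.2 (hz 0).symm
    have key : (1 - p ^ (n + 1)) * ∑ m ∈ range (n + 1 + 1), p ^ m.choose 2 * qHom y z p m
          / (qFin p p m * qFin p p (n + 1 - m) * qFin z p m)
        = ∑ m ∈ range (n + 1), p ^ m.choose 2 * qHom y z p m
            / (qFin p p m * qFin p p (n - m) * qFin z p m)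
          + p ^ n * (y + z) / (1 - z) * ∑ m ∈ range (n + 1), p ^ m.choose 2 * qHom y (z * p) p m
            / (qFin p p m * qFin p p (n - m) * qFin (z * p) p m) := by
      -- Split 1 - p^(n+1) as (1 - p^(n+1-m)) + p^(n+1-m) (1 - p^m). The first part lowers n - m;
      -- the second lowers m and, after a shift of index, replaces z by z p. This is why the
      -- induction generalizes z.
      have e1 : (1 - p ^ (n + 1)) * ∑ m ∈ range (n + 1 + 1), p ^ m.choose 2 * qHom y z p m
            / (qFin p p m * qFin p p (n + 1 - m) * qFin z p m)
          = ∑ m ∈ range (n + 1 + 1), (1 - p ^ (n + 1 - m)) * (p ^ m.choose 2 * qHom y z p m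
            / (qFin p p m * qFin p p (n + 1 - m) * qFin z p m))
          + ∑ m ∈ range (n + 1 + 1), p ^ (n + 1 - m) * (1 - p ^ m) * (p ^ m.choose 2 * qHom y z p m
            / (qFin p p m * qFin p p (n + 1 - m) * qFin z p m)) := by
        rw [mul_sum, ← sum_add_distrib]
        refine sum_congr rfl fun m hm => ?_
        have : p ^ (n + 1) = p ^ (n + 1 - m) * p ^ m := by
          rw [← pow_add]; congr 1; simp at hm; omega
        rw [this]; ring
      rw [e1, sum_range_succ, sum_range_succ' (fun m => p ^ (n + 1 - m) * (1 - p ^ m) * _)]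
      simp only [Nat.sub_self, pow_zero, sub_self, zero_mul, add_zero, mul_zero]
      congr 1
      · refine sum_congr rfl fun m hm => ?_
        have hm' : m ≤ n := by simpa [Nat.lt_succ_iff] using hm
        obtain ⟨d, rfl⟩ := Nat.exists_eq_add_of_le hm'
        have a1 : m + d + 1 - m = d + 1 := by omega
        have a2 : m + d - m = d := by omega
        have hd : (1 - p ^ (d + 1)) ≠ 0 := sub_ne_zero.2 (hp d).symm
        rw [a1, a2, qFin_succ p p d, ← pow_succ']
        have := h0 m; have := h0 d; have := h1 m
        field_simp
      · rw [mul_sum]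
        refine sum_congr rfl fun m hm => ?_
        have hm' : m ≤ n := by simpa [Nat.lt_succ_iff] using hm
        obtain ⟨d, rfl⟩ := Nat.exists_eq_add_of_le hm'
        have a1 : m + d + 1 - (m + 1) = d := by omega
        have a2 : m + d - m = d := by omega
        have hd : (1 - p ^ (m + 1)) ≠ 0 := sub_ne_zero.2 (hp m).symm
        rw [a1, a2, qFin_succ p p m, ← pow_succ', qFin_succ' z, qHom_succ', pow_choose_two, pow_add p m d]
        have := h0 m; have := h0 d; have := h2 m
        rw [mul_comm z p] at *
        field_simp
    rw [ih z hz, ih (z * p) hz'] at key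
    have e3 : (1 - z) * qFin (z * p) p n = qFin z p n * (1 - z * p ^ n) := by
      rw [← qFin_succ', qFin_succ]
    have e4 : qFin (z * p) p n = qFin z p n * (1 - z * p ^ n) / (1 - z) := by
      rw [← e3]; field_simp
    refine mul_left_cancel₀ hn (key.trans ?_)
    rw [e4, qFin_succ (-y), qFin_succ p, qFin_succ z, ← pow_succ']
    have := h0 n; have := h1 n
    have hzn' : (1 - p ^ n * z) ≠ 0 := by rwa [mul_comm]
    field_simp
    ring

/-- The sum `∑_{n ≤ L} α_n / ((p; p)_{L-n} (p; p)_{L+n+c})`: the second member of a Bailey pair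
relative to `p ^ c`, up to a factor depending only on `c`. -/
noncomputable def baileySum (p : ℂ) (c : ℕ) (α : ℕ → ℂ) (L : ℕ) : ℂ :=
  ∑ n ∈ range (L + 1), α n / (qFin p p (L - n) * qFin p p (L + n + c))

/-- With N = n + m, the factor (p; p)_{N+n+c} splits off (p^(2n+c+1); p)_m, and the cross term
p^(nm) from the binomial exponent is absorbed into `qHom`. The sum over m is then `qVandermonde` at
p^n y and p^(2n+c+1). -/
theorem baileyKernel_sum {p : ℂ} (hp : ∀ i, p ^ (i + 1) ≠ 1) (c : ℕ) {y : ℂ}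
    (hy : ∀ i, -y * p ^ i ≠ 1) {n L : ℕ} (hn : n ≤ L) :
    ∑ N ∈ Ico n (L + 1), p ^ N.choose 2 * qHom y (p ^ (c + 1)) p N
        / (qFin p p (L - N) * qFin (-y) p L) / (qFin p p (N - n) * qFin p p (N + n + c))
      = p ^ n.choose 2 * qHom y (p ^ (c + 1)) p n / qFin (-y) p n
        / (qFin p p (L - n) * qFin p p (L + n + c)) := by
  obtain ⟨d, rfl⟩ := Nat.exists_eq_add_of_le hn
  have hz : ∀ i, p ^ (2 * n + c + 1) * p ^ i ≠ 1 := fun i => by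
    rw [← pow_add, show 2 * n + c + 1 + i = (2 * n + c + i) + 1 by ring]; exact hp _
  have V := qVandermonde hp (p ^ n * y) (p ^ (2 * n + c + 1)) hz d
  have h0 := qFin_self_ne_zero hp
  have h1 := qFin_ne_zero hz
  have h2 := qFin_ne_zero hy
  have hsplit : ∀ m, qFin p p (n + m + n + c)
      = qFin p p (2 * n + c) * qFin (p ^ (2 * n + c + 1)) p m := fun m => by
    rw [show n + m + n + c = (2 * n + c) + m by ring, qFin_add, ← pow_succ']
  have hy2 : qFin (-y) p (n + d) = qFin (-y) p n * qFin (-(p ^ n * y)) p d := by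
    rw [qFin_add]; congr 2; ring
  have hy3 : qFin (-(p ^ n * y)) p d ≠ 0 := fun h => h2 (n + d) (by rw [hy2, h, mul_zero])
  rw [sum_Ico_eq_sum_range, show n + d + 1 - n = d + 1 by omega, show n + d - n = d by omega]
  calc _ = p ^ n.choose 2 * qHom y (p ^ (c + 1)) p n / (qFin (-y) p (n + d) * qFin p p (2 * n + c))
        * ∑ m ∈ range (d + 1), p ^ m.choose 2 * qHom (p ^ n * y) (p ^ (2 * n + c + 1)) p m
        / (qFin p p m * qFin p p (d - m) * qFin (p ^ (2 * n + c + 1)) p m) := by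
        rw [mul_sum]
        refine sum_congr rfl fun m _ => ?_
        rw [hsplit, show n + d - (n + m) = d - m by omega, show n + m - n = m by omega,
          add_choose_two, qHom_add,
          show p ^ (2 * n + c + 1) = p ^ n * (p ^ (c + 1) * p ^ n) by ring, qHom_mul,
          pow_add, pow_add, pow_mul]
        ring
    _ = _ := by
        rw [V, hsplit, hy2]
        have := h0 d; have := h0 (2 * n + c); have := h1 d; have := h2 n
        rw [mul_comm (p ^ n) y] at *
        field_simp

/-- A Bailey lemma: one of the two parameters is `-p ^ (c + 1) / y`, the other is infinite. -/
theorem baileySum_step {p : ℂ} (hp : ∀ i, p ^ (i + 1) ≠ 1) (c : ℕ) {y : ℂ}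
    (hy : ∀ i, -y * p ^ i ≠ 1) (α : ℕ → ℂ) (L : ℕ) :
    ∑ N ∈ range (L + 1), p ^ N.choose 2 * qHom y (p ^ (c + 1)) p N
        / (qFin p p (L - N) * qFin (-y) p L) * baileySum p c α N
      = baileySum p c
          (fun n => α n * (p ^ n.choose 2 * qHom y (p ^ (c + 1)) p n / qFin (-y) p n)) L := by
  simp only [baileySum, mul_sum]
  rw [sum_comm' (t' := range (L + 1)) (s' := fun n => Ico n (L + 1))]
  · refine sum_congr rfl fun n hn => ?_
    rw [mul_div_assoc, ← baileyKernel_sum hp c hy (by simpa [Nat.lt_succ_iff] using hn), mul_sum]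
    exact sum_congr rfl fun N _ => by ring
  · intro a b; simp; omega

/-- The unit Bailey pair relative to `p`. -/
theorem baileySum_unit {p : ℂ} (hp : ∀ i, p ^ (i + 1) ≠ 1) (L : ℕ) :
    baileySum p 1 (fun n => (-1) ^ n * p ^ n.choose 2 * (1 - p ^ (2 * n + 1))) L
      = if L = 0 then 1 else 0 := by
  have h0 := qFin_self_ne_zero hp
  rcases L with _ | K
  · have := hp 0
    have h : (1 - p) ≠ 0 := by simpa using sub_ne_zero.2 this.symm
    simp [baileySum, qFin_succ, h]
  · have hK : (1 - p ^ (K + 1)) ≠ 0 := sub_ne_zero.2 (hp K).symm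
    -- The sum telescopes. The closed form is used only up to M = K = L - 1, where K - M is a
    -- genuine difference; it then cancels the last term.
    have partialSum : ∀ M ≤ K, ∑ n ∈ range (M + 1), (-1) ^ n * p ^ n.choose 2 * (1 - p ^ (2 * n + 1))
          / (qFin p p (K + 1 - n) * qFin p p (K + 1 + n + 1))
        = (-1) ^ M * p ^ (M + 1).choose 2 * (1 - p ^ (M + 1))
          / (qFin p p (K - M) * qFin p p (K + M + 2) * (1 - p ^ (K + 1))) := by
      intro M hM
      induction M with
      | zero =>
        have := h0 K; have := h0 (K + 2)
        simp only [zero_add, range_one, sum_singleton, pow_zero, one_mul, Nat.choose_zero_succ,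
          mul_zero, pow_one, Nat.sub_zero, add_zero, qFin_succ p p K, ← pow_succ']
        simp
        field_simp
      | succ M ih =>
        obtain ⟨d, rfl⟩ := Nat.exists_eq_add_of_le hM
        have hd : (1 - p ^ (d + 1)) ≠ 0 := sub_ne_zero.2 (hp _).symm
        have hd2 : (1 - p ^ (2 * M + d + 4)) ≠ 0 := sub_ne_zero.2 (hp _).symm
        rw [sum_range_succ, ih (by omega), show M + 1 + d + 1 - (M + 1) = d + 1 by omega,
          show M + 1 + d - M = d + 1 by omega, show M + 1 + d - (M + 1) = d by omega,
          show M + 1 + d + 1 + (M + 1) + 1 = 2 * M + d + 4 by ring,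
          show M + 1 + d + M + 2 = 2 * M + d + 3 by ring,
          show M + 1 + d + (M + 1) + 2 = (2 * M + d + 3) + 1 by ring,
          show 2 * M + d + 4 = (2 * M + d + 3) + 1 by ring,
          qFin_succ p p d, qFin_succ p p (2 * M + d + 3), pow_choose_two p (M + 1),
          ← pow_succ', ← pow_succ']
        have := h0 d; have := h0 (2 * M + d + 3)
        have hd3 : (1 - p ^ (2 * M + d + 3 + 1)) ≠ 0 := hd2
        field_simp
        ring
    rw [baileySum, sum_range_succ, partialSum K le_rfl]
    have := h0 (K + K + 2)
    simp only [Nat.sub_self, qFin_zero, Nat.add_eq_zero_iff, one_ne_zero, and_false, if_false,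
      one_mul]
    rw [show K + 1 + (K + 1) + 1 = (K + K + 2) + 1 by ring, qFin_succ p p (K + K + 2), ← pow_succ',
      show 2 * (K + 1) + 1 = K + K + 2 + 1 by ring]
    have hd3 : (1 - p ^ (K + K + 2 + 1)) ≠ 0 := sub_ne_zero.2 (hp _).symm
    rw [pow_succ (-1 : ℂ) K]
    generalize (1 - p ^ (K + K + 2 + 1)) = w at *
    field_simp
    ring

/-- Passage from a Bailey pair relative to `p` to one relative to `1`. -/
theorem one_add_mul_baileySum {p : ℂ} (hp : ∀ i, p ^ (i + 1) ≠ 1) (b : ℕ → ℂ) (L : ℕ) :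
    (1 + p ^ L) * baileySum p 1 (fun n => b n * (1 - p ^ (2 * n + 1))) L
      = baileySum p 0 (fun n => (1 + p ^ n) *
          (b n - if n = 0 then 0 else p ^ (n - 1) * b (n - 1))) L := by
  have h0 := qFin_self_ne_zero hp
  -- Termwise this is (1 + p^L)(1 - p^(2n+1)) = (1 + p^n)(1 - p^(L+n+1)) - p^n (1 + p^(n+1))(1 -
  -- p^(L-n)); the second piece joins the term of index n + 1.
  have hL : ∀ n ∈ range L, (1 + p ^ L) * (b n * (1 - p ^ (2 * n + 1))
        / (qFin p p (L - n) * qFin p p (L + n + 1)))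
      = (1 + p ^ n) * b n / (qFin p p (L - n) * qFin p p (L + n + 0))
        - p ^ n * (1 + p ^ (n + 1)) * b n
          / (qFin p p (L - (n + 1)) * qFin p p (L + (n + 1) + 0)) := by
    intro n hn
    obtain ⟨d, rfl⟩ := Nat.exists_eq_add_of_le (Nat.succ_le_of_lt (mem_range.1 hn))
    rw [Nat.succ_eq_add_one, show n + 1 + d - n = d + 1 by omega,
      show n + 1 + d - (n + 1) = d by omega,
      show n + 1 + d + (n + 1) + 0 = (2 * n + d + 1) + 1 by ring,
      show n + 1 + d + n + 0 = 2 * n + d + 1 by ring,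
      show n + 1 + d + n + 1 = (2 * n + d + 1) + 1 by ring,
      qFin_succ p p d, qFin_succ p p (2 * n + d + 1), ← pow_succ', ← pow_succ']
    have := h0 d; have := h0 (2 * n + d + 1)
    have hd : (1 - p ^ (d + 1)) ≠ 0 := sub_ne_zero.2 (hp _).symm
    have hd2 : (1 - p ^ (2 * n + d + 1 + 1)) ≠ 0 := sub_ne_zero.2 (hp _).symm
    field_simp
    ring
  rw [baileySum, mul_sum, sum_range_succ, sum_congr rfl hL, sum_sub_distrib, baileySum,
    sum_congr (s₁ := range (L + 1)) rfl (g := fun n => (1 + p ^ n) * b n / (qFin p p (L - n) * qFin p p (L + n + 0))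
      - (1 + p ^ n) * (if n = 0 then 0 else p ^ (n - 1) * b (n - 1))
          / (qFin p p (L - n) * qFin p p (L + n + 0))) (fun n _ => by rw [mul_sub, sub_div]),
    sum_sub_distrib, sum_range_succ,
    sum_range_succ' (fun n => ((1 + p ^ n) * if n = 0 then 0 else p ^ (n - 1) * b (n - 1)) / _)]
  -- At n = L the second piece vanishes, since 1 - p^(L-n) = 0; this end term is separate because L
  -- - (n + 1) would be truncated.
  have e : (1 + p ^ L) * (b L * (1 - p ^ (2 * L + 1)) / (qFin p p (L - L) * qFin p p (L + L + 1)))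
      = (1 + p ^ L) * b L / (qFin p p (L - L) * qFin p p (L + L + 0)) := by
    rw [qFin_succ, ← pow_succ', add_zero]
    have := h0 (L + L)
    have hd2 : (1 - p ^ (L + L + 1)) ≠ 0 := sub_ne_zero.2 (hp _).symm
    rw [two_mul]
    simp only [Nat.sub_self, qFin_zero]
    field_simp
  rw [e]
  simp only [Nat.add_eq_zero_iff, one_ne_zero, and_false, if_false, Nat.add_sub_cancel, if_true,
    mul_zero, zero_div, add_zero]
  rw [sub_add_eq_add_sub]
  congr 1
  exact sum_congr rfl fun n _ => by ring

/-! ### Infinite products, bounds and limits. -/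

open Filter Topology in
theorem tendsto_qFin (a : ℂ) {p : ℂ} (hp : ‖p‖ < 1) :
    Tendsto (qFin a p) atTop (𝓝 (qPochInf a p)) :=
  (multipliable_qPochInf a hp).tendsto_prod_tprod_nat

theorem qPochInf_ne_zero {a p : ℂ} (hp : ‖p‖ < 1) (h : ∀ i, a * p ^ i ≠ 1) :
    qPochInf a p ≠ 0 := by
  have hs : Summable (fun i : ℕ => ‖-(a * p ^ i)‖) := by
    simp only [norm_neg, norm_mul, norm_pow]
    exact (summable_geometric_of_lt_one (norm_nonneg p) hp).mul_left ‖a‖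
  have := tprod_one_add_ne_zero_of_summable (f := fun i : ℕ => -(a * p ^ i))
    (fun i => by rw [← sub_eq_add_neg]; exact sub_ne_zero.2 (h i).symm) hs
  simpa [qPochInf, sub_eq_add_neg] using this

theorem qPochInf_eq_mul (a : ℂ) {p : ℂ} (hp : ‖p‖ < 1) (n : ℕ) :
    qPochInf a p = qFin a p n * qPochInf (a * p ^ n) p := by
  have h1 := (tendsto_qFin a hp).comp (Filter.tendsto_add_atTop_nat n)
  have h2 := (tendsto_qFin (a * p ^ n) hp).const_mul (qFin a p n)
  refine tendsto_nhds_unique h1 (h2.congr fun m => ?_)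
  simp only [Function.comp, add_comm m n, qFin_add]

theorem mul_pow_ne_one {a p : ℂ} (ha : ‖a‖ < 1) (hp : ‖p‖ < 1) (i : ℕ) : a * p ^ i ≠ 1 := by
  intro h
  have h1 : ‖a‖ * ‖p‖ ^ i = 1 := by rw [← norm_pow, ← norm_mul, h, norm_one]
  have h2 : ‖p‖ ^ i ≤ 1 := pow_le_one₀ (norm_nonneg _) hp.le
  nlinarith [norm_nonneg a]

theorem pow_succ_ne_one {p : ℂ} (hp : ‖p‖ < 1) (i : ℕ) : p ^ (i + 1) ≠ 1 := by
  rw [pow_succ']; exact mul_pow_ne_one hp hp i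

theorem exists_norm_inv_qFin_le {a p : ℂ} (hp : ‖p‖ < 1) (h : ∀ i, a * p ^ i ≠ 1) :
    ∃ C, 0 ≤ C ∧ ∀ n, ‖(qFin a p n)⁻¹‖ ≤ C := by
  have h1 := ((tendsto_qFin a hp).inv₀ (qPochInf_ne_zero hp h)).norm
  obtain ⟨C, hC⟩ := h1.bddAbove_range
  exact ⟨C, (norm_nonneg _).trans (hC ⟨0, rfl⟩), fun n => hC ⟨n, rfl⟩⟩

/-- Each factor is at most t (1 + ‖p‖^j), and the product of the 1 + ‖p‖^j is bounded by an
exponential. The resulting decay t^n drives all convergence of the multisum. -/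
theorem exists_norm_qHom_le {y z p : ℂ} {t : ℝ} (hp : ‖p‖ < 1) (hy : ‖y‖ ≤ t) (hz : ‖z‖ ≤ t) :
    ∃ C, 0 ≤ C ∧ ∀ n, ‖qHom y z p n‖ ≤ C * t ^ n := by
  have hs := summable_geometric_of_lt_one (norm_nonneg p) hp
  have ht : 0 ≤ t := (norm_nonneg y).trans hy
  refine ⟨Real.exp (∑' j, ‖p‖ ^ j), (Real.exp_pos _).le, fun n => ?_⟩
  calc ‖qHom y z p n‖ = ∏ j ∈ range n, ‖y + z * p ^ j‖ := by rw [qHom, norm_prod]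
    _ ≤ ∏ j ∈ range n, (Real.exp (‖p‖ ^ j) * t) := by
        refine prod_le_prod (fun _ _ => norm_nonneg _) fun j _ => ?_
        calc ‖y + z * p ^ j‖ ≤ ‖y‖ + ‖z‖ * ‖p‖ ^ j := by
              rw [← norm_pow, ← norm_mul]; exact norm_add_le _ _
          _ ≤ t + t * ‖p‖ ^ j := by gcongr
          _ = (‖p‖ ^ j + 1) * t := by ring
          _ ≤ _ := by gcongr; exact Real.add_one_le_exp _
    _ = Real.exp (∑ j ∈ range n, ‖p‖ ^ j) * t ^ n := by
        rw [prod_mul_distrib, Real.exp_sum, prod_const, card_range]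
    _ ≤ _ := by
        gcongr
        exact hs.sum_le_tsum _ fun _ _ => by positivity

-- Dominated convergence: both denominators tend to (p; p)_∞ and their inverses are uniformly
-- bounded, so summability of α is enough.
open Filter Topology in
theorem tendsto_baileySum {p : ℂ} (hp : ‖p‖ < 1) (c : ℕ) {α : ℕ → ℂ}
    (hα : Summable fun n => ‖α n‖) :
    Tendsto (baileySum p c α) atTop (𝓝 ((∑' n, α n) / qPochInf p p ^ 2)) := by
  have hne : ∀ i, p * p ^ i ≠ 1 := mul_pow_ne_one hp hp
  obtain ⟨C, hC0, hC⟩ := exists_norm_inv_qFin_le hp hne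
  have h0 := qPochInf_ne_zero hp hne
  have e : ∀ L, baileySum p c α L
      = ∑' n, if n ≤ L then α n / (qFin p p (L - n) * qFin p p (L + n + c)) else 0 := by
    intro L
    rw [tsum_eq_sum (s := range (L + 1)), baileySum]
    · refine sum_congr rfl fun n hn => ?_
      rw [if_pos (by simpa [Nat.lt_succ_iff] using hn)]
    · intro n hn
      rw [if_neg (by simpa [Nat.lt_succ_iff] using hn)]
  rw [tendsto_congr e, ← tsum_div_const]
  refine tendsto_tsum_of_dominated_convergence (bound := fun n => ‖α n‖ * (C * C))
    (hα.mul_right _) (fun n => ?_) (Eventually.of_forall fun L n => ?_)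
  · have h1 : Tendsto (fun L => qFin p p (L - n)) atTop (𝓝 (qPochInf p p)) :=
      (tendsto_qFin p hp).comp (tendsto_sub_atTop_nat n)
    have h2 : Tendsto (fun L => qFin p p (L + n + c)) atTop (𝓝 (qPochInf p p)) := by
      simp only [add_assoc]
      exact (tendsto_qFin p hp).comp (tendsto_add_atTop_nat (n + c))
    rw [pow_two]
    refine (tendsto_const_nhds.div (h1.mul h2) (mul_ne_zero h0 h0)).congr' ?_
    filter_upwards [eventually_ge_atTop n] with L hL
    rw [if_pos hL]; rfl
  · split_ifs
    · rw [div_eq_mul_inv, mul_inv, norm_mul, norm_mul]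
      gcongr
      · exact hC _
      · exact hC _
    · simp; positivity

/-! ### The Jacobi triple product. -/

/-- A finite form of the Jacobi triple product identity. -/
theorem baileySum_tripleProduct {P A B : ℂ} (hP : ∀ i, P ^ (i + 1) ≠ 1) (hP0 : P ≠ 0)
    (hAB : A * B = P) (L : ℕ) :
    baileySum P 0
        (fun n => if n = 0 then 1 else (-1) ^ n * P ^ n.choose 2 * (A ^ n + B ^ n)) L
      = qFin A P L * qFin B P L / qFin P P (2 * L) := by
  have hA0 : A ≠ 0 := fun h => hP0 (by rw [← hAB, h, zero_mul])
  -- The choice w = A P^(-L) centres the q-binomial sum of length 2L: (w; P)_{2L} = (w; P)_L (A;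
  -- P)_L, and reversing (w; P)_L produces (B; P)_L because w P^(L-1) B = 1. The terms L + n and L -
  -- n then pair into A^n + B^n.
  obtain ⟨w, hw⟩ : ∃ w, w * P ^ L = A := ⟨A / P ^ L, by field_simp⟩
  have hw0 : w ≠ 0 := fun h => hA0 (by rw [← hw, h, zero_mul])
  have hwB : w * P ^ L * B = P := by rw [hw, hAB]
  have V := qVandermonde hP (-w) 0 (fun i => by simp) (2 * L)
  have hy : ∀ m, qHom (-w) 0 P m = (-w) ^ m := fun m => by simp [qHom]
  have hz : ∀ m, qFin 0 P m = 1 := fun m => by simp [qFin]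
  simp only [hy, hz, neg_neg, mul_one] at V
  have hfac : qFin w P L = (-w) ^ L * P ^ L.choose 2 * qFin B P L := by
    have h1 : qFin w P L = ∏ i ∈ range L, (-w) * P ^ (L - 1 - i) * (1 - B * P ^ i) := by
      rw [qFin, ← prod_range_reflect]
      refine prod_congr rfl fun i hi => ?_
      obtain ⟨d, rfl⟩ := Nat.exists_eq_add_of_le (Nat.succ_le_of_lt (mem_range.1 hi))
      have h2 : w * P ^ d * (B * P ^ i) = 1 := by
        refine mul_right_cancel₀ hP0 ?_
        calc _ = w * P ^ (i.succ + d) * B := by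
              rw [pow_add, Nat.succ_eq_add_one, pow_succ]; ring
          _ = _ := by rw [hwB, one_mul]
      rw [show i.succ + d - 1 - i = d by omega]
      linear_combination (-1) * h2
    rw [h1, prod_mul_distrib, prod_mul_distrib, prod_const, card_range, prod_pow_eq_pow_sum,
      sum_range_reflect (fun i => i), sum_range_id, ← Nat.choose_two_right]
    rfl
  have hK : (-w) ^ L * P ^ L.choose 2 ≠ 0 :=
    mul_ne_zero (pow_ne_zero _ (neg_ne_zero.2 hw0)) (pow_ne_zero _ hP0)
  refine mul_left_cancel₀ hK ?_
  rw [two_mul, qFin_add w, hw, hfac] at V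
  rw [two_mul, ← mul_div_assoc, show (-w) ^ L * P ^ L.choose 2 * (qFin A P L * qFin B P L)
    = (-w) ^ L * P ^ L.choose 2 * qFin B P L * qFin A P L by ring, ← V,
    show L + L + 1 = L + (L + 1) by ring, sum_range_add, sum_range_succ', ← sum_range_reflect,
    ← add_assoc, ← sum_add_distrib, baileySum, sum_range_succ', mul_add, mul_sum]
  congr 1
  · refine sum_congr rfl fun n hn => ?_
    obtain ⟨d, rfl⟩ := Nat.exists_eq_add_of_le (Nat.succ_le_of_lt (mem_range.1 hn))
    rw [if_neg (Nat.succ_ne_zero n), Nat.succ_eq_add_one]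
    simp only [show n + 1 + d - 1 - n = d by omega, show n + 1 + d - (n + 1) = d by omega,
      show n + 1 + d + (n + 1 + d) - d = n + 1 + d + (n + 1) by omega, add_zero,
      show n + 1 + d + (n + 1 + d) - (n + 1 + d + (n + 1)) = d by omega]
    rw [Nat.succ_eq_add_one] at hw hwB
    generalize n + 1 = N at hw hwB ⊢
    have e1 : P ^ (N + d).choose 2 * (-w) ^ (N + d) * ((-1) ^ N * P ^ N.choose 2 * A ^ N)
        = P ^ (N + d + N).choose 2 * (-w) ^ (N + d + N) := by
      rw [← hw, add_choose_two (N + d) N, pow_add P (_ + _), pow_add P ((N + d).choose 2),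
        pow_add (-w) (N + d), pow_mul P (N + d), mul_pow,
        neg_pow w N]
      ring
    have e2 : P ^ (N + d).choose 2 * (-w) ^ (N + d) * ((-1) ^ N * P ^ N.choose 2 * B ^ N)
        = P ^ d.choose 2 * (-w) ^ d := by
      have e3 : P ^ (2 * N.choose 2 + N * d) * w ^ N * B ^ N = 1 := by
        refine mul_right_cancel₀ (pow_ne_zero N hP0) ?_
        have : 2 * N.choose 2 + N = N * N := by
          have := add_choose_two N N
          have h4 : (N + N).choose 2 = N * (N + N - 1) := by
            rw [Nat.choose_two_right, show (N + N) * (N + N - 1) = 2 * (N * (N + N - 1)) by ring,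
              Nat.mul_div_cancel_left _ (by norm_num)]
          rw [h4] at this
          rcases N with _ | N
          · simp
          · rw [show N + 1 + (N + 1) - 1 = 2 * N + 1 by omega] at this
            nlinarith
        calc _ = P ^ (2 * N.choose 2 + N + N * d) * w ^ N * B ^ N := by ring
          _ = (w * P ^ (N + d) * B) ^ N := by rw [this]; ring
          _ = _ := by rw [hwB, one_mul]
      calc _ = P ^ d.choose 2 * (-w) ^ d * (P ^ (2 * N.choose 2 + N * d) * w ^ N * B ^ N)
            * ((-1) ^ N * (-1) ^ N) := by
            rw [add_choose_two, pow_add (-w), neg_pow w N]; ring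
        _ = _ := by rw [e3, ← mul_pow]; simp
    rw [← e1, ← e2]
    ring
  · simp
    ring

/-- The Jacobi triple product identity. -/
theorem tripleProduct {P A B : ℂ} (hP : ‖P‖ < 1) (hP0 : P ≠ 0) (hA : ‖A‖ < 1) (hB : ‖B‖ < 1)
    (hAB : A * B = P) :
    (Summable fun n : ℕ =>
      ‖if n = 0 then 1 else (-1) ^ n * P ^ n.choose 2 * (A ^ n + B ^ n)‖) ∧
    ∑' n : ℕ, (if n = 0 then 1 else (-1) ^ n * P ^ n.choose 2 * (A ^ n + B ^ n))
      = qPochInf A P * qPochInf B P * qPochInf P P := by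
  have hs : Summable fun n : ℕ =>
      ‖if n = 0 then 1 else (-1) ^ n * P ^ n.choose 2 * (A ^ n + B ^ n)‖ := by
    refine Summable.of_nonneg_of_le (fun _ => norm_nonneg _) (fun n => ?_)
      ((summable_geometric_of_lt_one (norm_nonneg A) hA).add
        (summable_geometric_of_lt_one (norm_nonneg B) hB))
    split_ifs with h
    · simp [h]
    · have h1 : ‖P‖ ^ n.choose 2 ≤ 1 := pow_le_one₀ (norm_nonneg _) hP.le
      rw [norm_mul, norm_mul, norm_pow, norm_neg, norm_one, one_pow, one_mul, norm_pow]
      calc _ ≤ 1 * ‖A ^ n + B ^ n‖ := by gcongr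
        _ ≤ _ := by rw [one_mul, ← norm_pow, ← norm_pow]; exact norm_add_le _ _
  refine ⟨hs, ?_⟩
  have h0 := qPochInf_ne_zero hP (mul_pow_ne_one hP hP)
  have h1 := tendsto_baileySum hP 0 hs
  have h2 := ((tendsto_qFin A hP).mul (tendsto_qFin B hP)).div
    ((tendsto_qFin P hP).comp (Filter.tendsto_id.const_mul_atTop' (show 0 < 2 by norm_num))) h0
  have h3 := tendsto_nhds_unique h1
    (h2.congr fun L => (baileySum_tripleProduct (pow_succ_ne_one hP) hP0 hAB L).symm)
  field_simp at h3
  rw [h3]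
  ring

/-! ### Multisums as sums over paths of kernels. -/

/-- The entry `N_i` of a tuple, for `1 ≤ i ≤ m`, extended by `0`. -/
def tupleEntry {m : ℕ} (N : Fin m → ℕ) (i : ℕ) : ℕ :=
  if h : 1 ≤ i ∧ i ≤ m then N ⟨i - 1, by omega⟩ else 0

theorem tupleEntry_succ {m : ℕ} (N : Fin m → ℕ) (i : Fin m) :
    tupleEntry N (i + 1) = N i := by
  rw [tupleEntry, dif_pos ⟨by omega, by omega⟩]
  rfl

theorem tupleEntry_of_lt {m i : ℕ} (N : Fin m → ℕ) (h : m < i) : tupleEntry N i = 0 := by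
  rw [tupleEntry, dif_neg (by omega)]

theorem tupleEntry_cons {m : ℕ} (a : ℕ) (N : Fin m → ℕ) (i : ℕ) :
    tupleEntry (Fin.cons a N : Fin (m + 1) → ℕ) (i + 1) = if i = 0 then a else tupleEntry N i := by
  rcases i with _ | i
  · simp [tupleEntry]
  · simp only [tupleEntry, Nat.add_eq_zero_iff, one_ne_zero, and_false, if_false]
    by_cases h : i + 1 ≤ m
    · rw [dif_pos ⟨by omega, by omega⟩, dif_pos ⟨by omega, h⟩]
      exact Fin.cons_succ (α := fun _ => ℕ) a N ⟨i, by omega⟩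
    · rw [dif_neg (by omega), dif_neg (by omega)]

theorem summable_prod_pow {t : ℝ} (ht0 : 0 ≤ t) (ht : t < 1) (m : ℕ) :
    Summable (fun N : Fin m → ℕ => ∏ i, t ^ N i) := by
  induction m with
  | zero => exact Summable.of_finite
  | succ m ih =>
    rw [← (Fin.consEquiv fun _ => ℕ).summable_iff]
    have := (summable_geometric_of_lt_one ht0 ht).mul_of_nonneg ih (fun _ => by positivity)
      (fun _ => prod_nonneg fun _ _ => by positivity)
    refine this.congr fun x => ?_
    simp [Fin.consEquiv, Fin.prod_univ_succ]

/-- The product of a sequence of kernels along a path `L, N_1, …, N_m, 0`. -/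
noncomputable def pathProd (K : ℕ → ℕ → ℕ → ℂ) {m : ℕ} (L : ℕ) (N : Fin m → ℕ) : ℂ :=
  ∏ i ∈ range (m + 1), K i (if i = 0 then L else tupleEntry N i) (tupleEntry N (i + 1))

theorem norm_pathProd_le {K : ℕ → ℕ → ℕ → ℂ} {C : ℕ → ℝ} {t : ℝ} {m : ℕ}
    (hK : ∀ i ≤ m, ∀ L N, ‖K i L N‖ ≤ C i * t ^ N) (L : ℕ) (N : Fin m → ℕ) :
    ‖pathProd K L N‖ ≤ (∏ i ∈ range (m + 1), C i) * ∏ i, t ^ N i := by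
  have h : ∏ i, t ^ N i = ∏ i ∈ range (m + 1), t ^ tupleEntry N (i + 1) := by
    rw [prod_range_succ, tupleEntry_of_lt N (by omega : m < m + 1), pow_zero, mul_one, prod_range]
    exact prod_congr rfl fun i _ => by rw [tupleEntry_succ]
  rw [pathProd, norm_prod, h, ← prod_mul_distrib]
  exact prod_le_prod (fun _ _ => norm_nonneg _) fun i hi =>
    hK i (by simpa [Nat.lt_succ_iff] using hi) _ _

theorem summable_pathProd {K : ℕ → ℕ → ℕ → ℂ} {C : ℕ → ℝ} {t : ℝ} {m : ℕ} (ht0 : 0 ≤ t)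
    (ht : t < 1) (hK : ∀ i ≤ m, ∀ L N, ‖K i L N‖ ≤ C i * t ^ N) (L : ℕ) :
    Summable (fun N : Fin m → ℕ => pathProd K L N) :=
  Summable.of_norm_bounded ((summable_prod_pow ht0 ht m).mul_left _) (norm_pathProd_le hK L)

/-- Peel off N_1 and sum the remaining entries by induction. Summing the fibres first is legitimate
because the geometric bounds already give summability of the whole family. -/
theorem hasSum_pathProd {C : ℕ → ℝ} {t : ℝ} (ht0 : 0 ≤ t) (ht : t < 1) {m : ℕ}
    {K : ℕ → ℕ → ℕ → ℂ} {β : ℕ → ℕ → ℂ} (hK : ∀ i ≤ m, ∀ L N, ‖K i L N‖ ≤ C i * t ^ N)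
    (hβ : ∀ i < m, ∀ L, HasSum (fun N => K i L N * β (i + 1) N) (β i L))
    (hm : ∀ L, β m L = K m L 0) (L : ℕ) :
    HasSum (fun N : Fin m → ℕ => pathProd K L N) (β 0 L) := by
  induction m generalizing K β C L with
  | zero =>
    rw [hm]
    convert hasSum_unique (fun N : Fin 0 → ℕ => pathProd K L N) using 1
    simp [pathProd, tupleEntry]
  | succ m ih =>
    have hs := summable_pathProd ht0 ht hK L
    have hs' := (Fin.consEquiv fun _ => ℕ).summable_iff.2 hs
    have peel : ∀ (a : ℕ) (N : Fin m → ℕ), pathProd K L (Fin.cons a N : Fin (m + 1) → ℕ)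
        = K 0 L a * pathProd (fun i => K (i + 1)) a N := by
      intro a N
      rw [pathProd, prod_range_succ', pathProd, mul_comm]
      congr 1
      refine prod_congr rfl fun i _ => ?_
      · rw [if_neg (Nat.succ_ne_zero i), tupleEntry_cons, tupleEntry_cons,
          if_neg (Nat.succ_ne_zero i)]
    have h1 : ∀ a, HasSum (fun N : Fin m → ℕ => pathProd K L (Fin.cons a N : Fin (m + 1) → ℕ))
        (K 0 L a * β 1 a) := by
      intro a
      simp only [peel]
      exact (ih (K := fun i => K (i + 1)) (β := fun i => β (i + 1)) (C := fun i => C (i + 1))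
        (fun i hi => hK (i + 1) (by omega)) (fun i hi => hβ (i + 1) (by omega)) hm a).mul_left _
    have h2 := hs'.hasSum.prod_fiberwise h1
    have h3 := h2.unique (hβ 0 (by omega) L)
    rw [← h3]
    exact (Fin.consEquiv fun _ => ℕ).hasSum_iff.1 hs'.hasSum

-- Only the kernel of index 0 depends on L, and the bounds are uniform in L, so dominated
-- convergence allows L → ∞ inside the multisum.
open Filter Topology in
theorem hasSum_limit_pathProd {C : ℕ → ℝ} {t : ℝ} (ht0 : 0 ≤ t) (ht : t < 1) {m : ℕ}
    {K : ℕ → ℕ → ℕ → ℂ} {β : ℕ → ℕ → ℂ} (hK : ∀ i ≤ m, ∀ L N, ‖K i L N‖ ≤ C i * t ^ N)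
    (hβ : ∀ i < m, ∀ L, HasSum (fun N => K i L N * β (i + 1) N) (β i L))
    (hm : ∀ L, β m L = K m L 0) {κ : ℕ → ℂ} {ℓ : ℂ}
    (hκ : ∀ N, Tendsto (fun L => K 0 L N) atTop (𝓝 (κ N))) (hℓ : Tendsto (β 0) atTop (𝓝 ℓ)) :
    HasSum (fun N : Fin m → ℕ => κ (tupleEntry N 1) *
      ∏ i ∈ range m, K (i + 1) (tupleEntry N (i + 1)) (tupleEntry N (i + 2))) ℓ := by
  have hlim : ∀ N : Fin m → ℕ, Tendsto (fun L => pathProd K L N) atTop (𝓝 (κ (tupleEntry N 1) *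
      ∏ i ∈ range m, K (i + 1) (tupleEntry N (i + 1)) (tupleEntry N (i + 2)))) := by
    intro N
    refine ((hκ (tupleEntry N 1)).mul_const _).congr fun L => ?_
    rw [pathProd, prod_range_succ', mul_comm]
    simp
  have hb := (summable_prod_pow ht0 ht m).mul_left (∏ i ∈ range (m + 1), C i)
  have hsum : Summable (fun N : Fin m → ℕ => κ (tupleEntry N 1) *
      ∏ i ∈ range m, K (i + 1) (tupleEntry N (i + 1)) (tupleEntry N (i + 2))) :=
    Summable.of_norm_bounded hb fun N =>
      le_of_tendsto (hlim N).norm (Eventually.of_forall fun L => norm_pathProd_le hK L N)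
  have h1 := tendsto_tsum_of_dominated_convergence hb hlim
    (Eventually.of_forall fun L N => norm_pathProd_le hK L N)
  have h2 : ∀ L, ∑' N : Fin m → ℕ, pathProd K L N = β 0 L := fun L =>
    (hasSum_pathProd ht0 ht hK hβ hm L).tsum_eq
  rw [tendsto_congr h2] at h1
  rw [← tendsto_nhds_unique h1 hℓ]
  exact hsum.hasSum

theorem antitone_of_tupleEntry_le {m : ℕ} {N : Fin m → ℕ}
    (h : ∀ i < m, tupleEntry N (i + 2) ≤ tupleEntry N (i + 1)) : Antitone N := by
  have : Antitone fun i => tupleEntry N (i + 1) := antitone_nat_of_succ_le fun i => by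
    by_cases hi : i < m
    · exact h i hi
    · rw [tupleEntry_of_lt N (by omega)]; exact Nat.zero_le _
  intro i j hij
  rw [← tupleEntry_succ N i, ← tupleEntry_succ N j]
  exact this hij

theorem tupleEntry_antitone {m : ℕ} {N : Fin m → ℕ} (h : Antitone N) {i j : ℕ} (hi : 1 ≤ i)
    (hij : i ≤ j) : tupleEntry N j ≤ tupleEntry N i := by
  by_cases hj : j ≤ m
  · rw [tupleEntry, tupleEntry, dif_pos ⟨by omega, hj⟩, dif_pos ⟨hi, by omega⟩]
    exact h (by simp; omega)
  · rw [tupleEntry_of_lt N (by omega)]; exact Nat.zero_le _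

/-! ### The chain of Bailey pairs. -/

/-- The numerator attached to the entry `N_i = N`. -/
noncomputable def stepWeight (r : ℕ) (p : ℂ) (y : ℕ → ℂ) (i N : ℕ) : ℂ :=
  p ^ N.choose 2 * qHom (y i) p p N * (if i < r then 1 else if i = r then 1 + p ^ N else p ^ N)

/-- The kernel of the `i`-th Bailey step, from `N_{i+1} = N` to `N_i = L`. -/
noncomputable def stepKernel (r : ℕ) (p : ℂ) (y : ℕ → ℂ) (i L N : ℕ) : ℂ :=
  if N ≤ L then stepWeight r p y (i + 1) N / (qFin p p (L - N) * qFin (-(y (i + 1))) p L) else 0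

/-- The factor by which a Bailey step multiplies the first member of a Bailey pair. -/
noncomputable def stepFactor (p y : ℂ) (n : ℕ) : ℂ :=
  p ^ n.choose 2 * qHom y p p n / qFin (-y) p n

/-- The coefficients `(-1)^n p^{n(n-1)/2 + d n(n+1)}`. -/
noncomputable def unitCoeff (p : ℂ) (d n : ℕ) : ℂ :=
  (-1) ^ n * p ^ n.choose 2 * (p ^ (2 * (n + 1).choose 2)) ^ d

/-- The Bailey pair relative to `1` obtained from the `d`-fold iterate relative to `p`. -/
noncomputable def baseCoeff (p : ℂ) (d n : ℕ) : ℂ :=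
  (1 + p ^ n) * (unitCoeff p d n - if n = 0 then 0 else p ^ (n - 1) * unitCoeff p d (n - 1))

/-- The inner sum over `N_{i+1}, …, N_{k-1}`, as a function of `N_i`. -/
noncomputable def innerSum (k r : ℕ) (p : ℂ) (y : ℕ → ℂ) (i : ℕ) : ℕ → ℂ :=
  if i < r then
    baileySum p 0 (fun n => baseCoeff p (k - r) n * ∏ s ∈ Ico i r, stepFactor p (y (s + 1)) n)
  else baileySum p 1 (fun n => unitCoeff p (k - i) n * (1 - p ^ (2 * n + 1)))

theorem innerSum_of_lt (k : ℕ) {r i : ℕ} (p : ℂ) (y : ℕ → ℂ) (h : i < r) :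
    innerSum k r p y i = baileySum p 0
      (fun n => baseCoeff p (k - r) n * ∏ s ∈ Ico i r, stepFactor p (y (s + 1)) n) :=
  if_pos h

theorem innerSum_of_le (k : ℕ) {r i : ℕ} (p : ℂ) (y : ℕ → ℂ) (h : r ≤ i) :
    innerSum k r p y i = baileySum p 1 (fun n => unitCoeff p (k - i) n * (1 - p ^ (2 * n + 1))) :=
  if_neg (not_lt.2 h)

/-- One link of the chain. There are three cases: a step relative to 1, the step at r = i + 1 that
also changes the base, and a step relative to p with y = 0. -/
theorem innerSum_step {k r : ℕ} {p : ℂ} {y : ℕ → ℂ} (hp : ‖p‖ < 1) (hy : ∀ i, ‖y i‖ < 1)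
    (hyr : ∀ i, r < i → y i = 0) {i : ℕ} (hi : i < k) (L : ℕ) :
    HasSum (fun N => stepKernel r p y i L N * innerSum k r p y (i + 1) N)
      (innerSum k r p y i L) := by
  have hp1 := pow_succ_ne_one hp
  have hyi : ∀ s, ∀ j, -(y s) * p ^ j ≠ 1 := fun s => mul_pow_ne_one (by simpa using hy s) hp
  have main : ∑ N ∈ range (L + 1), stepKernel r p y i L N * innerSum k r p y (i + 1) N
      = innerSum k r p y i L := by
    have h1 : ∑ N ∈ range (L + 1), stepKernel r p y i L N * innerSum k r p y (i + 1) N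
        = ∑ N ∈ range (L + 1), stepWeight r p y (i + 1) N
          / (qFin p p (L - N) * qFin (-(y (i + 1))) p L) * innerSum k r p y (i + 1) N :=
      sum_congr rfl fun N hN => by
        rw [stepKernel, if_pos (by simpa [Nat.lt_succ_iff] using hN)]
    rw [h1]
    by_cases hir : i < r
    · by_cases hir' : i + 1 < r
      · have e : (fun n => baseCoeff p (k - r) n * ∏ s ∈ Ico i r, stepFactor p (y (s + 1)) n)
            = fun n => (baseCoeff p (k - r) n * ∏ s ∈ Ico (i + 1) r, stepFactor p (y (s + 1)) n)
              * (p ^ n.choose 2 * qHom (y (i + 1)) (p ^ (0 + 1)) p n / qFin (-(y (i + 1))) p n) := by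
          funext n
          rw [prod_eq_prod_Ico_succ_bot hir, zero_add, pow_one, stepFactor]
          ring
        rw [innerSum_of_lt k p y hir, innerSum_of_lt k p y hir', e, ← baileySum_step hp1 0 (hyi (i + 1))]
        refine sum_congr rfl fun N _ => ?_
        rw [stepWeight, if_pos hir', zero_add, pow_one, mul_one]
      · obtain rfl : r = i + 1 := by omega
        have e : (fun n => baseCoeff p (k - (i + 1)) n *
              ∏ s ∈ Ico i (i + 1), stepFactor p (y (s + 1)) n)
            = fun n => baseCoeff p (k - (i + 1)) n
              * (p ^ n.choose 2 * qHom (y (i + 1)) (p ^ (0 + 1)) p n / qFin (-(y (i + 1))) p n) := by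
          funext n
          rw [Nat.Ico_succ_singleton, prod_singleton, zero_add, pow_one, stepFactor]
        rw [innerSum_of_lt k p y hir, innerSum_of_le k p y le_rfl, e, ← baileySum_step hp1 0 (hyi (i + 1))]
        refine sum_congr rfl fun N _ => ?_
        -- The factor 1 + p^N in the weight is exactly what turns the pair relative to p into one
        -- relative to 1.
        have h2 : _ = baileySum p 0 (baseCoeff p (k - (i + 1))) N :=
          one_add_mul_baileySum hp1 (unitCoeff p (k - (i + 1))) N
        rw [← h2, stepWeight, if_neg hir', if_pos rfl, zero_add, pow_one]
        ring
    · have e : (fun n => unitCoeff p (k - i) n * (1 - p ^ (2 * n + 1)))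
            = fun n => (unitCoeff p (k - (i + 1)) n * (1 - p ^ (2 * n + 1)))
              * (p ^ n.choose 2 * qHom 0 (p ^ (1 + 1)) p n / qFin (-0) p n) := by
          funext n
          have : qFin (-0) p n = 1 := by simp [qFin]
          rw [this, div_one, qHom_zero_left, unitCoeff, unitCoeff,
            show k - i = (k - (i + 1)) + 1 by omega, pow_succ _ (k - (i + 1)), pow_mul' p 2,
            pow_choose_two]
          ring
      have h0 : y (i + 1) = 0 := hyr _ (by omega)
      rw [innerSum_of_le k p y (not_lt.1 hir), innerSum_of_le k p y (by omega), e,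
        ← baileySum_step hp1 1 (by simp)]
      refine sum_congr rfl fun N _ => ?_
      -- Relative to p the second argument of `qHom` is p^2 instead of p; for y = 0 the difference
      -- is the factor p^N of the weight.
      rw [stepWeight, if_neg (by omega), if_neg (by omega), h0, qHom_zero_left, qHom_zero_left]
      ring
  rw [← main]
  refine hasSum_sum_of_ne_finset_zero fun N hN => ?_
  rw [stepKernel, if_neg (by simpa [Nat.lt_succ_iff] using hN), zero_mul]

theorem innerSum_last {k r : ℕ} {p : ℂ} {y : ℕ → ℂ} (hp : ‖p‖ < 1) (hkr : r ≤ k) (L : ℕ) :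
    innerSum k r p y k L = if L = 0 then 1 else 0 := by
  rw [innerSum_of_le k p y hkr, ← baileySum_unit (pow_succ_ne_one hp)]
  simp [unitCoeff]

theorem exists_norm_stepKernel_le {r : ℕ} {p : ℂ} {y : ℕ → ℂ} {t : ℝ} (ht : t < 1) (hp : ‖p‖ ≤ t)
    (hy : ∀ i, ‖y i‖ ≤ t) (i : ℕ) :
    ∃ C, ∀ L N, ‖stepKernel r p y i L N‖ ≤ C * t ^ N := by
  have hp1 := hp.trans_lt ht
  have ht0 : 0 ≤ t := (norm_nonneg p).trans hp
  obtain ⟨C₁, hC₁, h₁⟩ := exists_norm_qHom_le (z := p) hp1 (hy (i + 1)) hp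
  obtain ⟨C₂, hC₂, h₂⟩ := exists_norm_inv_qFin_le hp1 (mul_pow_ne_one hp1 hp1)
  obtain ⟨C₃, hC₃, h₃⟩ := exists_norm_inv_qFin_le (a := -(y (i + 1))) hp1
    (mul_pow_ne_one (by simpa using (hy (i + 1)).trans_lt ht) hp1)
  refine ⟨C₁ * 2 * (C₂ * C₃), fun L N => ?_⟩
  rw [stepKernel]
  split_ifs with h
  · have hpow : ∀ n : ℕ, ‖p ^ n‖ ≤ 1 := fun n => by
      rw [norm_pow]; exact pow_le_one₀ (norm_nonneg _) hp1.le
    have he : ‖(if i + 1 < r then 1 else if i + 1 = r then 1 + p ^ N else p ^ N : ℂ)‖ ≤ 2 := by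
      have := hpow N
      split_ifs
      · simp
      · refine (norm_add_le _ _).trans ?_
        rw [norm_one]; linarith
      · linarith
    rw [stepWeight, div_eq_mul_inv, mul_inv]
    simp only [norm_mul]
    calc _ ≤ 1 * (C₁ * t ^ N) * 2 * (C₂ * C₃) := by
          gcongr
          · exact hpow _
          · exact h₁ _
          · exact h₂ _
          · exact h₃ _
      _ = _ := by ring
  · rw [norm_zero]; positivity

open Filter Topology in
theorem tendsto_stepKernel {r : ℕ} {p : ℂ} {y : ℕ → ℂ} (hp : ‖p‖ < 1) (hy : ∀ i, ‖y i‖ < 1)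
    (i N : ℕ) :
    Tendsto (fun L => stepKernel r p y i L N) atTop
      (𝓝 (stepWeight r p y (i + 1) N / (qPochInf p p * qPochInf (-(y (i + 1))) p))) := by
  have h1 : Tendsto (fun L => qFin p p (L - N)) atTop (𝓝 (qPochInf p p)) :=
    (tendsto_qFin p hp).comp (tendsto_sub_atTop_nat N)
  have h2 := tendsto_qFin (-(y (i + 1))) hp
  have h0 := qPochInf_ne_zero hp (mul_pow_ne_one hp hp)
  have h3 := qPochInf_ne_zero hp (mul_pow_ne_one (a := -(y (i + 1))) (by simpa using hy _) hp)
  refine (tendsto_const_nhds.div (h1.mul h2) (mul_ne_zero h0 h3)).congr' ?_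
  filter_upwards [eventually_ge_atTop N] with L hL
  rw [stepKernel, if_pos hL]; rfl

/-- The limit L → ∞ of the whole chain: the multisum on one side, the sum of the final Bailey
coefficients on the other. -/
theorem hasSum_stepKernel {k r : ℕ} {p : ℂ} {y : ℕ → ℂ} {t : ℝ} (ht : t < 1) (hp : ‖p‖ ≤ t)
    (hy : ∀ i, ‖y i‖ ≤ t) (hyr : ∀ i, r < i → y i = 0) (hr : 0 < r) (hkr : r ≤ k)
    (hs : Summable fun n => ‖baseCoeff p (k - r) n * ∏ s ∈ range r, stepFactor p (y (s + 1)) n‖) :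
    HasSum (fun N : Chain k =>
      stepWeight r p y 1 (N.entry 1) / (qPochInf p p * qPochInf (-(y 1)) p) *
        ∏ i ∈ range (k - 1), stepWeight r p y (i + 2) (N.entry (i + 2))
          / (qFin p p (N.entry (i + 1) - N.entry (i + 2))
            * qFin (-(y (i + 2))) p (N.entry (i + 1))))
      ((∑' n, baseCoeff p (k - r) n * ∏ s ∈ range r, stepFactor p (y (s + 1)) n)
        / qPochInf p p ^ 2) := by
  have hp1 := hp.trans_lt ht
  have hy1 := fun i => (hy i).trans_lt ht
  choose C hC using exists_norm_stepKernel_le (r := r) ht hp hy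
  -- The unit pair is concentrated at N_k = 0, so the innermost sum is a single kernel value.
  have hlast : ∀ L, innerSum k r p y (k - 1) L = stepKernel r p y (k - 1) L 0 := fun L => by
    refine (innerSum_step hp1 hy1 hyr (by omega : k - 1 < k) L).unique ?_
    rw [show k - 1 + 1 = k by omega]
    simp only [innerSum_last hp1 hkr]
    convert hasSum_ite_eq 0 (stepKernel r p y (k - 1) L 0) using 2 with N
    split_ifs with h
    · rw [h, mul_one]
    · rw [mul_zero]
  have hlim := tendsto_baileySum hp1 0 hs
  have h0 : innerSum k r p y 0
      = baileySum p 0 (fun n => baseCoeff p (k - r) n * ∏ s ∈ range r, stepFactor p (y (s + 1)) n) := by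
    rw [innerSum_of_lt k p y hr, range_eq_Ico]
  rw [← h0] at hlim
  have H := hasSum_limit_pathProd (m := k - 1) ((norm_nonneg p).trans hp) ht (fun i _ => hC i)
    (fun i hi => innerSum_step hp1 hy1 hyr (by omega : i < k)) hlast
    (tendsto_stepKernel hp1 hy1 0) hlim
  -- Kernels vanish unless N ≤ L, so the sum over all tuples lives on the chains.
  rw [← hasSum_subtype_iff_of_support_subset (s := {N | Antitone N})] at H
  · refine Eq.mpr (congrArg (fun f : Chain k → ℂ => HasSum f _) (funext fun N => ?_)) H
    have hN : ∀ i, 1 ≤ i → tupleEntry N.1 (i + 1) ≤ tupleEntry N.1 i := fun i hi =>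
      tupleEntry_antitone N.2 hi (Nat.le_succ i)
    simp only [Function.comp]
    congr 1
    refine prod_congr rfl fun i _ => ?_
    rw [stepKernel, if_pos (hN (i + 1) (by omega))]
    rfl
  · intro N hN
    refine antitone_of_tupleEntry_le fun i hi => ?_
    by_contra hlt
    refine hN ?_
    simp only
    rw [prod_eq_zero (mem_range.2 hi), mul_zero]
    rw [stepKernel, if_neg hlt]

/-! ### The chosen parameters and the resulting theta series. -/

theorem prod_Icc_one_eq_prod_range {M : Type*} [CommMonoid M] (f : ℕ → M) (m : ℕ) :
    ∏ i ∈ Icc 1 m, f i = ∏ i ∈ range m, f (i + 1) := by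
  induction m with
  | zero => simp
  | succ m ih => rw [prod_Icc_succ_top (by omega), ih, prod_range_succ]

theorem IsAdmissible.prod_reflect {l η : ℕ} {α : ℕ → ℕ} (h : IsAdmissible l η α) {M : Type*}
    [CommMonoid M] (f : ℕ → M) :
    ∏ s ∈ range l, f (η - α (s + 1)) = ∏ s ∈ range l, f (α (s + 1)) := by
  rw [← prod_range_reflect]
  refine prod_congr rfl fun s hs => ?_
  have hs' := mem_range.1 hs
  have h1 := h.symm (l - 1 - s + 1) (mem_Icc.2 ⟨by omega, by omega⟩)
  rw [show l + 1 - (l - 1 - s + 1) = s + 1 by omega] at h1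
  congr 1
  omega

theorem IsAdmissible.two_mul_sum {l η : ℕ} {α : ℕ → ℕ} (h : IsAdmissible l η α) :
    2 * ∑ s ∈ range l, α (s + 1) = l * η := by
  have h1 := h.prod_reflect (M := Multiplicative ℕ) Multiplicative.ofAdd
  rw [← ofAdd_sum, ← ofAdd_sum] at h1
  have h2 : ∑ s ∈ range l, (η - α (s + 1)) = ∑ s ∈ range l, α (s + 1) := h1
  have h3 : ∑ s ∈ range l, (η - α (s + 1) + α (s + 1)) = l * η := by
    rw [sum_congr rfl (g := fun _ => η)]
    · simp
    · intro s hs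
      have := h.lt_eta (s + 1) (mem_Icc.2 ⟨by omega, by simpa using hs⟩)
      omega
  rw [sum_add_distrib] at h3
  omega

/-- The finite parameters of the Bailey steps. -/
noncomputable def stepParam (l η : ℕ) (α : ℕ → ℕ) (q : ℂ) (i : ℕ) : ℂ :=
  if i = l + 1 then q ^ η else if 1 ≤ i ∧ i ≤ l then q ^ (η - α i) else 0

theorem stepParam_last (l η : ℕ) (α : ℕ → ℕ) (q : ℂ) : stepParam l η α q (l + 1) = q ^ η :=
  if_pos rfl

theorem stepParam_of_lt {l s : ℕ} (η : ℕ) (α : ℕ → ℕ) (q : ℂ) (h : s < l) :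
    stepParam l η α q (s + 1) = q ^ (η - α (s + 1)) := by
  rw [stepParam, if_neg (by omega), if_pos ⟨by omega, h⟩]

theorem stepParam_of_gt {l i : ℕ} (η : ℕ) (α : ℕ → ℕ) (q : ℂ) (h : l + 1 < i) :
    stepParam l η α q i = 0 := by
  rw [stepParam, if_neg (by omega), if_neg (by omega)]

theorem norm_stepParam_le {l η : ℕ} {α : ℕ → ℕ} (h : IsAdmissible l η α) {q : ℂ} (hq : ‖q‖ < 1)
    (i : ℕ) : ‖stepParam l η α q i‖ ≤ ‖q‖ := by
  have hpow : ∀ m, 0 < m → ‖q ^ m‖ ≤ ‖q‖ := fun m hm => by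
    rw [norm_pow]; exact pow_le_of_le_one (norm_nonneg _) hq.le hm.ne'
  rw [stepParam]
  split_ifs with h1 h2
  · exact hpow _ h.eta_pos
  · have := h.lt_eta i (mem_Icc.2 h2)
    exact hpow _ (by omega)
  · simp

/-- For y = q^(η - α_i) the step factor contains (-q^(α_i); p)_n / (-q^(η - α_i); p)_n. These
quotients need not be 1 individually, but the reflection i ↦ λ + 1 - i makes their product 1. -/
theorem prod_stepFactor_lt {l η : ℕ} {α : ℕ → ℕ} (h : IsAdmissible l η α) {q : ℂ} (hq : ‖q‖ < 1)
    (n : ℕ) :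
    ∏ s ∈ range l, stepFactor (q ^ η) (stepParam l η α q (s + 1)) n
      = (q ^ ∑ s ∈ range l, α (s + 1)) ^ n * ((q ^ η) ^ n.choose 2) ^ l := by
  have hp : ‖q ^ η‖ < 1 := by
    rw [norm_pow]; exact pow_lt_one₀ (norm_nonneg _) hq h.eta_pos.ne'
  have e : ∀ s ∈ range l, stepFactor (q ^ η) (stepParam l η α q (s + 1)) n
      = (q ^ η) ^ n.choose 2 * (q ^ (η - α (s + 1))) ^ n
        * (qFin (-q ^ α (s + 1)) (q ^ η) n / qFin (-q ^ (η - α (s + 1))) (q ^ η) n) := by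
    intro s hs
    have hs' := h.lt_eta (s + 1) (mem_Icc.2 ⟨by omega, by simpa using hs⟩)
    have h1 : q ^ η = q ^ (η - α (s + 1)) * q ^ α (s + 1) := by
      rw [← pow_add]; congr 1; omega
    have h2 : qHom (q ^ (η - α (s + 1))) (q ^ η) (q ^ η) n
        = (q ^ (η - α (s + 1))) ^ n * qFin (-q ^ α (s + 1)) (q ^ η) n := by
      have := qHom_mul (q ^ (η - α (s + 1))) 1 (q ^ α (s + 1)) (q ^ η) n
      rwa [mul_one, ← h1, qHom_one] at this
    rw [stepFactor, stepParam_of_lt _ _ _ (mem_range.1 hs), h2]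
    ring
  rw [prod_congr rfl e, prod_mul_distrib, prod_mul_distrib, prod_const, card_range, prod_pow,
    prod_div_distrib, h.prod_reflect (fun m => qFin (-q ^ m) (q ^ η) n),
    h.prod_reflect (fun m => q ^ m), div_self, mul_one, prod_pow_eq_pow_sum, mul_comm]
  refine prod_ne_zero_iff.2 fun s hs => qFin_ne_zero (mul_pow_ne_one ?_ hp) n
  have := h.pos (s + 1) (mem_Icc.2 ⟨by omega, by simpa using hs⟩)
  rw [norm_neg, norm_pow]
  exact pow_lt_one₀ (norm_nonneg _) hq this.ne'

theorem one_add_pow_ne_zero {p : ℂ} (hp : ‖p‖ < 1) (n : ℕ) : (1 + p ^ n) ≠ 0 := by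
  rcases n with _ | n
  · norm_num
  · have := mul_pow_ne_one (a := -p) (by simpa using hp) hp n
    rw [pow_succ']
    intro h
    exact this (by linear_combination -h)

theorem qFin_neg_one {p : ℂ} (n : ℕ) : qFin (-1) p n * (1 + p ^ n) = 2 * qFin (-p) p n := by
  have h1 := qFin_succ (-1) p n
  rw [qFin_succ'] at h1
  rw [show -p = -1 * p by ring]
  linear_combination -h1

/-- The denominator 1 + p^n is the point of taking y = p: it removes the factor 1 + p^n of
`baseCoeff`. -/
theorem stepFactor_self {p : ℂ} (hp : ‖p‖ < 1) (n : ℕ) :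
    stepFactor p p n = p ^ n.choose 2 * p ^ n * 2 / (1 + p ^ n) := by
  have h1 := qHom_mul p 1 1 p n
  rw [mul_one, qHom_one] at h1
  have h2 := qFin_ne_zero (mul_pow_ne_one (a := -p) (by simpa using hp) hp) n
  have h3 := one_add_pow_ne_zero hp n
  rw [stepFactor, h1, div_eq_div_iff h2 h3]
  linear_combination p ^ n.choose 2 * p ^ n * qFin_neg_one (p := p) n

theorem stepFactor_zero (p : ℂ) (n : ℕ) : stepFactor p 0 n = (p ^ n.choose 2) ^ 2 * p ^ n := by
  have : qFin (-0) p n = 1 := by simp [qFin]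
  rw [stepFactor, this, qHom_zero_left]
  ring

/-- Since n + C(n,2) = C(n+1,2), the two terms of the difference share a power of p, and their
opposite signs turn it into a sum. This sum becomes A^n + B^n in the triple product. -/
theorem baseCoeff_succ (p : ℂ) (d n : ℕ) :
    baseCoeff p d (n + 1) = (1 + p ^ (n + 1)) * (-1) ^ (n + 1) * p ^ (n + 1).choose 2
      * (p ^ (n + 1).choose 2) ^ (2 * d) * ((p ^ (n + 1)) ^ (2 * d) + 1) := by
  rw [baseCoeff, if_neg (Nat.succ_ne_zero n), Nat.add_sub_cancel, unitCoeff, unitCoeff,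
    pow_mul' p 2 ((n + 1 + 1).choose 2), pow_mul' p 2 ((n + 1).choose 2), pow_choose_two p (n + 1)]
  have := pow_choose_two p n
  rw [this]
  ring

/-- The exponents of p^C(n,2) add up to 1 + 2(k - r) + λ + 1 + 2(r - λ - 1) = 2k - λ, the modulus of
the product side. -/
theorem coeff_eq {k r l η : ℕ} {α : ℕ → ℕ} (hkr : r ≤ k) (hrl : l < r) (h : IsAdmissible l η α)
    {q : ℂ} (hq : ‖q‖ < 1) (n : ℕ) :
    baseCoeff (q ^ η) (k - r) n
        * ∏ s ∈ range r, stepFactor (q ^ η) (stepParam l η α q (s + 1)) n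
      = 2 * if n = 0 then 1 else (-1) ^ n * ((q ^ η) ^ (2 * k - l)) ^ n.choose 2
        * (((q ^ η) ^ (2 * (k - r)) * (q ^ (∑ s ∈ range l, α (s + 1)) * (q ^ η) ^ (r - l))) ^ n
          + (q ^ (∑ s ∈ range l, α (s + 1)) * (q ^ η) ^ (r - l)) ^ n) := by
  have hp : ‖q ^ η‖ < 1 := by
    rw [norm_pow]; exact pow_lt_one₀ (norm_nonneg _) hq h.eta_pos.ne'
  rcases n with _ | n
  · simp [baseCoeff, unitCoeff, stepFactor]
    norm_num
  · rw [if_neg (Nat.succ_ne_zero n)]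
    obtain ⟨d, rfl⟩ := Nat.exists_eq_add_of_le (Nat.succ_le_of_lt hrl)
    obtain ⟨D, rfl⟩ := Nat.exists_eq_add_of_le hkr
    have e : ∏ s ∈ range (l.succ + d), stepFactor (q ^ η) (stepParam l η α q (s + 1)) (n + 1)
        = (q ^ ∑ s ∈ range l, α (s + 1)) ^ (n + 1) * ((q ^ η) ^ (n + 1).choose 2) ^ l
          * ((q ^ η) ^ (n + 1).choose 2 * (q ^ η) ^ (n + 1) * 2 / (1 + (q ^ η) ^ (n + 1)))
          * (((q ^ η) ^ (n + 1).choose 2) ^ 2 * (q ^ η) ^ (n + 1)) ^ d := by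
      rw [prod_range_add, prod_range_succ, prod_stepFactor_lt h hq, stepParam_last,
        stepFactor_self hp, prod_congr rfl (g := fun _ => _ ^ 2 * _) fun s _ => by
          rw [stepParam_of_gt _ _ _ (by omega), stepFactor_zero], prod_const, card_range]
    have h3 := one_add_pow_ne_zero hp (n + 1)
    rw [e, baseCoeff_succ, show l.succ + d + D - (l.succ + d) = D by omega,
      show 2 * (l.succ + d + D) - l = 2 * D + 2 + l + 2 * d by omega,
      show l.succ + d - l = d + 1 by omega]
    generalize q ^ η = p at *
    generalize q ^ (∑ s ∈ range l, α (s + 1)) = u at *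
    rw [pow_right_comm p (2 * D + 2 + l + 2 * d), mul_pow _ (u * _), mul_pow u,
      pow_right_comm p (2 * D), pow_right_comm p (d + 1)]
    generalize p ^ (n + 1).choose 2 = v at *
    generalize p ^ (n + 1) = w at *
    field_simp
    ring

/-! ### Identification of the summand. -/

theorem qPoch_natCast {a p : ℂ} (hp : ‖p‖ < 1) (n : ℕ) (h : ∀ i, a * p ^ n * p ^ i ≠ 1) :
    qPoch a p n = qFin a p n := by
  rw [qPoch, zpow_natCast, qPochInf_eq_mul a hp n, mul_div_assoc,
    div_self (qPochInf_ne_zero hp h), mul_one]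

theorem sq_eq_two_mul_choose_add (n : ℕ) : n ^ 2 = 2 * n.choose 2 + n := by
  induction n with
  | zero => rfl
  | succ n ih => rw [Nat.choose_succ_succ' n 1, Nat.choose_one_right]; nlinarith

theorem prod_pow_succ (p : ℂ) (n : ℕ) :
    ∏ i ∈ range n, p ^ (i + 1) = p ^ n.choose 2 * p ^ n := by
  induction n with
  | zero => simp
  | succ n ih => rw [prod_range_succ, ih, pow_choose_two]

/-- Reversed, the factors are 1 + x p^(-i-1); multiplying each by p^(i+1) gives x + p^(i+1) and uses
C(n,2) + n of the exponent n^2 = 2 C(n,2) + n. -/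
theorem pow_sq_mul_qFin {p : ℂ} (hp : p ≠ 0) (x : ℂ) (n : ℕ) :
    p ^ n ^ 2 * qFin (-(x * (p ^ n)⁻¹)) p n = p ^ n.choose 2 * qHom x p p n := by
  have e : p ^ n.choose 2 * p ^ n * qFin (-(x * (p ^ n)⁻¹)) p n = qHom x p p n := by
    rw [← prod_pow_succ, qHom, qFin, ← prod_range_reflect (fun i => 1 - _ * p ^ i),
      ← prod_mul_distrib]
    refine prod_congr rfl fun i hi => ?_
    obtain ⟨d, rfl⟩ := Nat.exists_eq_add_of_le (Nat.succ_le_of_lt (mem_range.1 hi))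
    rw [show i.succ + d - 1 - i = d by omega, Nat.succ_eq_add_one, pow_add p (i + 1) d]
    field_simp
    ring
  rw [← e, sq_eq_two_mul_choose_add, pow_add, two_mul, pow_add]
  ring

/-- From 1 + p^ν = p^ν (1 + p^(-ν)) at index r, the linear exponent starts at r itself. -/
theorem prod_stepExponent {p : ℂ} (hp : p ≠ 0) (ν : ℕ → ℕ) {r m : ℕ} (hr : 0 < r) (hm : r ≤ m) :
    ∏ i ∈ range m, (if i + 1 < r then 1 else if i + 1 = r then 1 + p ^ ν (i + 1)
        else p ^ ν (i + 1))
      = p ^ (∑ i ∈ Icc r m, ν i) * (1 + (p ^ ν r)⁻¹) := by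
  induction m, hm using Nat.le_induction with
  | base =>
    obtain ⟨s, rfl⟩ := Nat.exists_eq_add_of_le' hr
    rw [prod_range_succ, prod_eq_one fun i hi => if_pos (by simpa using hi), if_neg (by omega),
      if_pos rfl, Icc_self, sum_singleton]
    field_simp
    ring
  | succ m hm ih =>
    rw [prod_range_succ, ih, if_neg (by omega), if_neg (by omega), sum_Icc_succ_top (by omega),
      pow_add]
    ring

theorem prod_stepParam {k l η : ℕ} {α : ℕ → ℕ} (hlk : l < k) {q : ℂ} (hq : q ≠ 0)
    (ν : ℕ → ℕ) :
    ∏ i ∈ range k, ((q ^ η) ^ (ν (i + 1)).choose 2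
        * qHom (stepParam l η α q (i + 1)) (q ^ η) (q ^ η) (ν (i + 1)))
      = (q ^ η) ^ (∑ i ∈ range k, ν (i + 1) ^ 2)
        * (∏ s ∈ range l, qFin (-(q ^ (η - α (s + 1)) * ((q ^ η) ^ ν (s + 1))⁻¹)) (q ^ η)
            (ν (s + 1)))
        * qFin (-(q ^ η * ((q ^ η) ^ ν (l + 1))⁻¹)) (q ^ η) (ν (l + 1)) := by
  have hp : q ^ η ≠ 0 := pow_ne_zero _ hq
  obtain ⟨d, rfl⟩ := Nat.exists_eq_add_of_le (Nat.succ_le_of_lt hlk)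
  rw [prod_congr rfl fun i _ => (pow_sq_mul_qFin hp (stepParam l η α q (i + 1)) _).symm,
    prod_mul_distrib, prod_pow_eq_pow_sum, mul_assoc, prod_range_add _ l.succ d, prod_range_succ,
    stepParam_last, prod_congr rfl fun s hs => by rw [stepParam_of_lt _ _ _ (mem_range.1 hs)]]
  congr 1
  rw [prod_eq_one (s := range d), mul_one]
  intro i _
  rw [stepParam_of_gt _ _ _ (by omega)]
  simp [qFin]

theorem Chain.entry_of_le {k : ℕ} (N : Chain k) {i : ℕ} (h : k ≤ i) : N.entry i = 0 ∨ k = 0 := by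
  by_cases hk : k = 0
  · exact Or.inr hk
  · exact Or.inl (dif_neg (by omega))

theorem Chain.entry_succ_le {k : ℕ} (N : Chain k) (i : ℕ) :
    N.entry (i + 2) ≤ N.entry (i + 1) :=
  tupleEntry_antitone N.2 (by omega) (by omega)

theorem neg_zpow_sub {q : ℂ} (hq : q ≠ 0) (η n : ℕ) {a : ℕ} (ha : a ≤ η) :
    -q ^ ((η : ℤ) - a - η * n) = -(q ^ (η - a) * ((q ^ η) ^ n)⁻¹) := by
  rw [zpow_sub₀ hq, ← Nat.cast_sub ha, zpow_natCast, div_eq_mul_inv, ← Nat.cast_mul, zpow_natCast,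
    pow_mul]

/-- The n-th factor of (-p^(1-n); p)_n is 1 - (-1) = 2. Working with the infinite tails (-1; p)_∞ =
2 (-p; p)_∞ also covers n = 0, where the index is -1. -/
theorem qPoch_neg_one_eq {p : ℂ} (hp : ‖p‖ < 1) (hp0 : p ≠ 0) (n : ℕ) :
    qPoch (-(p * (p ^ n)⁻¹)) p ((n : ℤ) - 1) = qFin (-(p * (p ^ n)⁻¹)) p n / 2 := by
  have h1 : -(p * (p ^ n)⁻¹) * p ^ ((n : ℤ) - 1) = -1 := by
    rw [zpow_sub_one₀ hp0, zpow_natCast]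
    field_simp
  have h2 : -(p * (p ^ n)⁻¹) * p ^ n = -p := by field_simp
  have h3 : qPochInf (-1) p = 2 * qPochInf (-p) p := by
    rw [qPochInf_eq_mul (-1) hp 1, qFin_succ]
    norm_num
  have h4 := qPochInf_ne_zero hp (mul_pow_ne_one (a := -p) (by simpa using hp) hp)
  rw [qPoch, h1, qPochInf_eq_mul _ hp n, h2, h3]
  field_simp

/-- Each infinite product is a tail, (-y p^N; p)_∞ = (-y; p)_∞ / (-y; p)_N. The parameter at s + 1
is paired with the entry N_s, and `tailFactor` supplies the parameter p at λ + 1. -/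
theorem tailFactor_mul_prod {k l η : ℕ} {α : ℕ → ℕ} (h : IsAdmissible l η α) {q : ℂ}
    (hq0 : q ≠ 0) (hq : ‖q‖ < 1) (N : Chain k) :
    tailFactor l η q N
        * ∏ s ∈ Icc 2 l, qPochInf (-q ^ ((η : ℤ) - α s + η * N.entry (s - 1))) (q ^ η)
      = ∏ s ∈ range l, (qPochInf (-(stepParam l η α q (s + 2))) (q ^ η)
          / qFin (-(stepParam l η α q (s + 2))) (q ^ η) (N.entry (s + 1))) := by
  have hp : ‖q ^ η‖ < 1 := by
    rw [norm_pow]; exact pow_lt_one₀ (norm_nonneg _) hq h.eta_pos.ne'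
  have key : ∀ i n, qPochInf (-(stepParam l η α q i)) (q ^ η)
      / qFin (-(stepParam l η α q i)) (q ^ η) n
      = qPochInf (-(stepParam l η α q i) * (q ^ η) ^ n) (q ^ η) := fun i n => by
    have := qFin_ne_zero (mul_pow_ne_one (a := -(stepParam l η α q i))
      (by simpa using (norm_stepParam_le h hq i).trans_lt hq) hp) n
    rw [qPochInf_eq_mul _ hp n]
    field_simp
  simp only [key]
  rcases l with _ | l
  · simp [tailFactor]
  · rw [tailFactor, if_neg (Nat.succ_ne_zero l), prod_range_succ, stepParam_last, mul_comm]
    congr 1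
    · rw [show Icc 2 (l + 1) = Ico (0 + 2) (l + 2) by ext; simp; omega, ← prod_Ico_add',
        range_eq_Ico]
      refine prod_congr rfl fun s hs => ?_
      have hsl : s < l := (mem_Ico.1 hs).2
      have hs' := h.lt_eta (s + 2) (mem_Icc.2 ⟨by omega, by omega⟩)
      rw [stepParam_of_lt (s := s + 1) η α q (by omega), show s + 2 - 1 = s + 1 by omega,
        zpow_add₀ hq0, ← Nat.cast_sub hs'.le, zpow_natCast, ← Nat.cast_mul, zpow_natCast, pow_mul,
        neg_mul]
    · rw [pow_add, pow_mul, neg_mul]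

theorem summand_eq {k r l η : ℕ} {α : ℕ → ℕ} (hkr : r ≤ k) (hrl : l < r) (h : IsAdmissible l η α)
    {q : ℂ} (hq0 : q ≠ 0) (hq : ‖q‖ < 1) (N : Chain k) :
    summand k r l η α q N
      = stepWeight r (q ^ η) (stepParam l η α q) 1 (N.entry 1)
          / (qPochInf (q ^ η) (q ^ η) * qPochInf (-(stepParam l η α q 1)) (q ^ η)) *
        (∏ i ∈ range (k - 1), stepWeight r (q ^ η) (stepParam l η α q) (i + 2) (N.entry (i + 2))
          / (qFin (q ^ η) (q ^ η) (N.entry (i + 1) - N.entry (i + 2))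
            * qFin (-(stepParam l η α q (i + 2))) (q ^ η) (N.entry (i + 1))))
        * (qPochInf (q ^ η) (q ^ η) / 2
          * ∏ s ∈ range (l + 1), qPochInf (-(stepParam l η α q (s + 1))) (q ^ η)) := by
  have hp : ‖q ^ η‖ < 1 := by
    rw [norm_pow]; exact pow_lt_one₀ (norm_nonneg _) hq h.eta_pos.ne'
  have hp0 : q ^ η ≠ 0 := pow_ne_zero _ hq0
  have hy : ∀ i, ‖-(stepParam l η α q i)‖ < 1 := fun i => by
    rw [norm_neg]; exact (norm_stepParam_le h hq i).trans_lt hq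
  have hlast : N.entry k = 0 := (N.entry_of_le le_rfl).resolve_right (by omega)
  have weights : stepWeight r (q ^ η) (stepParam l η α q) 1 (N.entry 1)
        * ∏ i ∈ range (k - 1), stepWeight r (q ^ η) (stepParam l η α q) (i + 2) (N.entry (i + 2))
      = (q ^ η) ^ (∑ i ∈ Icc 1 (k - 1), N.entry i ^ 2)
        * (∏ s ∈ range l, qFin (-(q ^ (η - α (s + 1)) * ((q ^ η) ^ N.entry (s + 1))⁻¹)) (q ^ η)
            (N.entry (s + 1)))
        * qFin (-(q ^ η * ((q ^ η) ^ N.entry (l + 1))⁻¹)) (q ^ η) (N.entry (l + 1))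
        * ((q ^ η) ^ (∑ i ∈ Icc r (k - 1), N.entry i) * (1 + ((q ^ η) ^ N.entry r)⁻¹)) := by
    -- The ranges are extended to include N_k = 0, since r or λ + 1 may equal k.
    have e1 : ∑ i ∈ Icc 1 (k - 1), N.entry i ^ 2 = ∑ i ∈ range k, N.entry (i + 1) ^ 2 := by
      obtain ⟨m, rfl⟩ := Nat.exists_eq_add_of_le' (by omega : 1 ≤ k)
      rw [sum_range_succ, hlast, Nat.add_sub_cancel, range_eq_Ico,
        sum_Ico_add' (fun i => N.entry i ^ 2) 0 m 1]
      simp only [zero_add, ne_eq, OfNat.ofNat_ne_zero, not_false_eq_true, zero_pow, add_zero]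
      rfl
    have e2 : ∑ i ∈ Icc r (k - 1), N.entry i = ∑ i ∈ Icc r k, N.entry i := by
      obtain ⟨m, rfl⟩ := Nat.exists_eq_add_of_le' (by omega : 1 ≤ k)
      rw [sum_Icc_succ_top hkr, hlast, Nat.add_sub_cancel, add_zero]
    rw [e1, e2, ← prod_stepParam (by omega) hq0, ← prod_stepExponent hp0 N.entry (by omega) hkr,
      ← prod_mul_distrib]
    obtain ⟨m, rfl⟩ := Nat.exists_eq_add_of_le' (by omega : 1 ≤ k)
    rw [prod_range_succ', mul_comm, Nat.add_sub_cancel]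
    rfl
  have denoms : ∏ i ∈ Icc 1 (k - 1), qPoch (q ^ η) (q ^ η) ((N.entry i : ℤ) - N.entry (i + 1))
      = ∏ i ∈ range (k - 1), qFin (q ^ η) (q ^ η) (N.entry (i + 1) - N.entry (i + 2)) := by
    rw [prod_Icc_one_eq_prod_range]
    refine prod_congr rfl fun i _ => ?_
    rw [← Nat.cast_sub (N.entry_succ_le i), qPoch_natCast hp]
    intro j
    rw [mul_assoc, ← pow_add]
    exact mul_pow_ne_one hp hp _
  have lower : ∏ s ∈ Icc 1 l, qPoch (-q ^ ((η : ℤ) - α s - η * N.entry s)) (q ^ η) (N.entry s)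
      = ∏ s ∈ range l, qFin (-(q ^ (η - α (s + 1)) * ((q ^ η) ^ N.entry (s + 1))⁻¹)) (q ^ η)
            (N.entry (s + 1)) := by
    rw [prod_Icc_one_eq_prod_range]
    refine prod_congr rfl fun s hs => ?_
    have hs' := h.lt_eta (s + 1) (mem_Icc.2 ⟨by omega, by simpa using hs⟩)
    rw [neg_zpow_sub hq0 η _ hs'.le, qPoch_natCast hp]
    intro j
    have h1 : -(q ^ (η - α (s + 1)) * ((q ^ η) ^ N.entry (s + 1))⁻¹) * (q ^ η) ^ N.entry (s + 1)
        = -(stepParam l η α q (s + 1)) := by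
      rw [stepParam_of_lt _ _ _ (mem_range.1 hs)]
      field_simp
    rw [h1]
    exact mul_pow_ne_one (hy _) hp j
  have middle : qPoch (-q ^ ((η : ℤ) - η * N.entry (l + 1))) (q ^ η) ((N.entry (l + 1) : ℤ) - 1)
      = qFin (-(q ^ η * ((q ^ η) ^ N.entry (l + 1))⁻¹)) (q ^ η) (N.entry (l + 1)) / 2 := by
    have := neg_zpow_sub hq0 η (N.entry (l + 1)) (Nat.zero_le η)
    rw [Nat.cast_zero, sub_zero, Nat.sub_zero] at this
    rw [this, qPoch_neg_one_eq hp hp0]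
  -- Beyond index λ + 1 the parameters are zero and the factors are 1.
  have tails : ∏ i ∈ range (k - 1), qFin (-(stepParam l η α q (i + 2))) (q ^ η) (N.entry (i + 1))
      = ∏ i ∈ range l, qFin (-(stepParam l η α q (i + 2))) (q ^ η) (N.entry (i + 1)) := by
    obtain ⟨d, hd⟩ := Nat.exists_eq_add_of_le (by omega : l ≤ k - 1)
    rw [hd, prod_range_add, prod_eq_one (s := range d), mul_one]
    intro i _
    rw [stepParam_of_gt _ _ _ (by omega)]
    simp [qFin]
  have inv : q ^ (-((η : ℤ) * N.entry r)) = ((q ^ η) ^ N.entry r)⁻¹ := by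
    rw [zpow_neg, ← Nat.cast_mul, zpow_natCast, pow_mul]
  have h1 := qPochInf_ne_zero hp (mul_pow_ne_one hp hp)
  have h2 := qPochInf_ne_zero hp (mul_pow_ne_one (hy 1) hp)
  calc summand k r l η α q N
      = ((q ^ η) ^ (∑ i ∈ Icc 1 (k - 1), N.entry i ^ 2)
        * (∏ s ∈ range l, qFin (-(q ^ (η - α (s + 1)) * ((q ^ η) ^ N.entry (s + 1))⁻¹)) (q ^ η)
            (N.entry (s + 1)))
        * qFin (-(q ^ η * ((q ^ η) ^ N.entry (l + 1))⁻¹)) (q ^ η) (N.entry (l + 1))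
        * ((q ^ η) ^ (∑ i ∈ Icc r (k - 1), N.entry i) * (1 + ((q ^ η) ^ N.entry r)⁻¹))) / 2
        * (tailFactor l η q N
          * ∏ s ∈ Icc 2 l, qPochInf (-q ^ ((η : ℤ) - α s + η * N.entry (s - 1))) (q ^ η))
        / ∏ i ∈ range (k - 1), qFin (q ^ η) (q ^ η) (N.entry (i + 1) - N.entry (i + 2)) := by
        rw [summand, denoms, lower, middle, inv, pow_mul, pow_add]
        ring
    _ = _ := by
        rw [← weights, tailFactor_mul_prod h hq0 hq, prod_div_distrib, prod_div_distrib,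
          prod_mul_distrib, tails, prod_range_succ' _ l]
        field_simp

theorem mainTheorem5 (k r l η : ℕ) (α : ℕ → ℕ) (hkr : r ≤ k) (hrl : l < r)
    (hα : IsAdmissible l η α) (q : ℂ) (hq0 : q ≠ 0) (hq1 : ‖q‖ < 1) :
    HasSum (fun N : Chain k => summand k r l η α q N) (productSide k r l η α q) := by
  have hη := hα.eta_pos
  have hp0 : q ^ η ≠ 0 := pow_ne_zero _ hq0
  have hpow : ∀ m, 0 < m → ‖q ^ m‖ < 1 := fun m hm => by
    rw [norm_pow]; exact pow_lt_one₀ (norm_nonneg _) hq1 hm.ne'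
  have hpq : ‖q ^ η‖ ≤ ‖q‖ := by
    rw [norm_pow]; exact pow_le_of_le_one (norm_nonneg _) hq1.le hη.ne'
  have hH := hα.two_mul_sum
  have hA : (q ^ η) ^ (2 * (k - r)) * (q ^ (∑ s ∈ range l, α (s + 1)) * (q ^ η) ^ (r - l))
      = q ^ (η * (2 * (k - r)) + (∑ s ∈ range l, α (s + 1) + η * (r - l))) := by
    rw [← pow_mul, ← pow_mul, ← pow_add, ← pow_add]
  have hB : q ^ (∑ s ∈ range l, α (s + 1)) * (q ^ η) ^ (r - l)
      = q ^ (∑ s ∈ range l, α (s + 1) + η * (r - l)) := by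
    rw [← pow_mul, ← pow_add]
  have hP : (q ^ η) ^ (2 * k - l) = q ^ (η * (2 * k - l)) := (pow_mul _ _ _).symm
  have hpos : 0 < η * (r - l) := Nat.mul_pos hη (by omega)
  have hcoef := coeff_eq hkr hrl hα hq1
  rw [hA, hB, hP] at hcoef
  obtain ⟨hs, hT⟩ := tripleProduct (P := q ^ (η * (2 * k - l)))
    (A := q ^ (η * (2 * (k - r)) + (∑ s ∈ range l, α (s + 1) + η * (r - l))))
    (B := q ^ (∑ s ∈ range l, α (s + 1) + η * (r - l)))
    (hpow _ (Nat.mul_pos hη (by omega))) (pow_ne_zero _ hq0) (hpow _ (by omega))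
    -- The condition A B = P reduces to 2 ∑ α_i = λ η, the summed form of the symmetry of the
    -- residues.
    (hpow _ (by omega)) (by
      rw [← pow_add]
      congr 1
      obtain ⟨d, rfl⟩ := Nat.exists_eq_add_of_le hrl.le
      obtain ⟨D, rfl⟩ := Nat.exists_eq_add_of_le hkr
      rw [show l + d + D - (l + d) = D by omega, show l + d - l = d by omega,
        show 2 * (l + d + D) - l = l + 2 * d + 2 * D by omega]
      linarith)
  have H := hasSum_stepKernel (y := stepParam l η α q) hq1 hpq (norm_stepParam_le hα hq1)
    (fun i hi => stepParam_of_gt η α q (by omega)) (by omega) hkr (by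
      simp only [hcoef, norm_mul]
      exact hs.mul_left _)
  simp only [hcoef] at H
  rw [tsum_mul_left, hT] at H
  have H' := H.mul_right (qPochInf (q ^ η) (q ^ η) / 2
    * ∏ s ∈ range (l + 1), qPochInf (-(stepParam l η α q (s + 1))) (q ^ η))
  have hY : ∏ s ∈ range (l + 1), qPochInf (-(stepParam l η α q (s + 1))) (q ^ η)
      = (∏ s ∈ Icc 1 l, qPochInf (-q ^ α s) (q ^ η)) * qPochInf (-q ^ η) (q ^ η) := by
    rw [prod_range_succ, stepParam_last, prod_Icc_one_eq_prod_range,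
      ← hα.prod_reflect (fun m => qPochInf (-q ^ m) (q ^ η))]
    congr 1
    exact prod_congr rfl fun s hs => by rw [stepParam_of_lt _ _ _ (mem_range.1 hs)]
  -- This relation makes both integer divisions by 2 in `productSide` exact.
  have hZ : (l : ℤ) * η = 2 * ((∑ s ∈ range l, α (s + 1) : ℕ) : ℤ) := by exact_mod_cast hH.symm
  have zB : q ^ ((2 * (r : ℤ) - l) * η / 2) = q ^ (∑ s ∈ range l, α (s + 1) + η * (r - l)) := by
    rw [← zpow_natCast, Nat.cast_add, Nat.cast_mul, Nat.cast_sub hrl.le]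
    congr 1
    refine Int.ediv_eq_of_eq_mul_right (by norm_num) ?_
    linear_combination hZ
  have zA : q ^ ((4 * (k : ℤ) - 2 * r - l) * η / 2)
      = q ^ (η * (2 * (k - r)) + (∑ s ∈ range l, α (s + 1) + η * (r - l))) := by
    rw [← zpow_natCast]
    push_cast [Nat.cast_sub hrl.le, Nat.cast_sub hkr]
    congr 1
    refine Int.ediv_eq_of_eq_mul_right (by norm_num) ?_
    push_cast at hZ
    linear_combination hZ
  have zP : q ^ ((2 * (k : ℤ) - l) * η) = q ^ (η * (2 * k - l)) := by
    rw [← zpow_natCast]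
    push_cast [Nat.cast_sub (by omega : l ≤ 2 * k)]
    ring_nf
  have h0 := qPochInf_ne_zero (hpow η hη) (mul_pow_ne_one (hpow η hη) (hpow η hη))
  have e : productSide k r l η α q = 2 *
      (qPochInf (q ^ (η * (2 * (k - r)) + (∑ s ∈ range l, α (s + 1) + η * (r - l))))
          (q ^ (η * (2 * k - l)))
        * qPochInf (q ^ (∑ s ∈ range l, α (s + 1) + η * (r - l))) (q ^ (η * (2 * k - l)))
        * qPochInf (q ^ (η * (2 * k - l))) (q ^ (η * (2 * k - l)))) / qPochInf (q ^ η) (q ^ η) ^ 2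
      * (qPochInf (q ^ η) (q ^ η) / 2
      * ∏ s ∈ range (l + 1), qPochInf (-(stepParam l η α q (s + 1))) (q ^ η)) := by
    rw [hY]
    unfold productSide
    rw [zA, zB, zP]
    field_simp
  rw [funext (summand_eq hkr hrl hα hq0 hq1), e]
  exact H'
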